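/- Let $A$ be a finite set of agents, each of whom owns one divisible unit of its own good, and let $u_{ij}\ge 0$ be the utility of agent $i\in A$ per unit of the good of agent $j\in A$. Let $E=\{ij : u_{ij}>0\}$; the digraph $(A,E)$ may have loops. A market equilibrium consists of prices $p_i>0$ $(i\in A)$ and allocations $x_{ij}\ge 0$ $(ij\in E)$, with $x_{ij}=0$ for $ij\notin E$, such that $\sum_i x_{ij}=1$ for every $j$; $\sum_j x_{ij}p_j=p_i$ for every $i$; and every agent gets an optimal bundle: $(x_{ij})_j$ maximizes $\sum_j u_{ij}b_j$ over all $b\ge 0$ with $\sum_j b_jp_j\le p_i$, and $x_{ij}>0$ implies $u_{ij}/p_j=\max_{k\in A}u_{ik}/p_k$. Consider the program in the variables $y=(y_{ij})_{ij\in E}$, $p=(p_i)_{i\in A}$, $\beta=(\beta_i)_{i\in A}$ $$\text{(CP)}\qquad \min\ \sum_{i\in A}p_i\log\frac{p_i}{\beta_i}-\sum_{ij\in E}y_{ij}\log u_{ij}$$ subject to $$\sum_{i:\,ij\in E}y_{ij}=p_j\ (j\in A),\quad \sum_{j:\,ij\in E}y_{ij}=p_i\ (i\in A),\quad u_{ij}\beta_i\le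 p_j\ (ij\in E),\quad p_i\ge 1\ (i\in A),\quad y,\beta\ge 0,$$ where $p_i\log(p_i/\beta_i)=+\infty$ if $\beta_i=0$. Then: 1. (CP) is a convex program: its feasible region is convex and its objective is convex there. 2. (CP) is feasible if and only if the following condition holds: $(\star)$ every strongly connected component of $(A,E)$ that consists of a single node has a loop at that node. 3. If $(\star)$ holds, then the minimum in (CP) is attained and equals $0$, and for every optimal solution $(y,p,\beta)$ the prices $p_i$ and the allocations $x_{ij}=y_{ij}/p_j$ form a market equilibrium. 4. Define the bitsize of a rational number with lowest-terms representation $a/b$ as $\lceil\log_2|a|\rceil+\lceil\log_2 b\rceil$ (and as $0$ for the number $0$), and the input size of a market with rational utilities as $|A|+|E|$ plus the sum of the bitsizes of all $u_{ij}$, $ij\in E$. There is a polynomial $P$ such that for every market with rational utilities that satisfies $(\star)$ there is a rational optimal solution $(y,p,\beta)$ of (CP) that is an extreme point of the feasible region, such that $p$ and $x_{ij}=y_{ij}/p_j$ form a market equilibrium in rational numbers, and the total bitsize of all $p_i$ and $x_{ij}$ is at most $P$ of the input size. -/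

import Mathlib

namespace ArrowDebreu

/-- `ij` is an arc of the market digraph: agent `i` has positive utility for the good of `j`. -/
def Arc {A : Type*} (u : A → A → ℝ) (i j : A) : Prop := 0 < u i j

noncomputable instance {A : Type*} (u : A → A → ℝ) (i j : A) : Decidable (Arc u i j) :=
  Classical.propDecidable _

/-- The strongly connected component of the node `i` in the market digraph: the nodes that can be
reached from `i` and from which `i` can be reached. -/
def scc {A : Type*} (u : A → A → ℝ) (i : A) : Set A :=
  {j | Relation.ReflTransGen (Arc u) i j ∧ Relation.ReflTransGen (Arc u) j i}

/-- Condition (⋆): every one-element strongly connected component carries a loop. -/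
def SingletonComponentsHaveLoops {A : Type*} (u : A → A → ℝ) : Prop :=
  ∀ i : A, (scc u i).ncard = 1 → ∃ k ∈ scc u i, Arc u k k

/-- Market equilibrium with prices `p` and allocation `x`, in the market where every agent owns one
unit of its own good. The allocation lives on the arcs, i.e. it is extended by `0` to all pairs. -/
structure IsEquilibrium {A : Type*} [Fintype A] (u : A → A → ℝ) (p : A → ℝ) (x : A → A → ℝ) :
    Prop where
  price_pos : ∀ i, 0 < p i
  alloc_nonneg : ∀ i j, 0 ≤ x i j
  alloc_arc : ∀ i j, ¬ Arc u i j → x i j = 0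
  /-- every good is fully sold -/
  sold : ∀ j, ∑ i, x i j = 1
  /-- every agent spends exactly its income -/
  budget : ∀ i, ∑ j, x i j * p j = p i
  /-- every agent gets a utility maximizing bundle among those it can afford -/
  optimal_bundle : ∀ i, ∀ b : A → ℝ, (∀ j, 0 ≤ b j) → ∑ j, b j * p j ≤ p i →
    ∑ j, u i j * b j ≤ ∑ j, u i j * x i j
  /-- only goods of maximal bang-per-buck are bought -/
  best_buy : ∀ i j, 0 < x i j → ∀ k, u i k / p k ≤ u i j / p j

/-- The variables `(y, p, β)` of the convex program. -/
abbrev Vars (A : Type*) : Type _ := (A → A → ℝ) × (A → ℝ) × (A → ℝ)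

/-- The payments `y i j`. -/
abbrev Vars.pay {A : Type*} (z : Vars A) : A → A → ℝ := z.1

/-- The prices `p i`. -/
abbrev Vars.price {A : Type*} (z : Vars A) : A → ℝ := z.2.1

/-- The inverse best bang-per-buck values `β i`. -/
abbrev Vars.invBpb {A : Type*} (z : Vars A) : A → ℝ := z.2.2

/-- The constraints of the convex program. The payments are indexed by the arcs, i.e. they are
extended by `0` to all pairs. -/
structure IsFeasible {A : Type*} [Fintype A] (u : A → A → ℝ) (z : Vars A) : Prop where
  inflow : ∀ j, ∑ i with Arc u i j, z.pay i j = z.price j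
  outflow : ∀ i, ∑ j with Arc u i j, z.pay i j = z.price i
  bpb : ∀ i j, Arc u i j → u i j * z.invBpb i ≤ z.price j
  one_le_price : ∀ i, 1 ≤ z.price i
  pay_nonneg : ∀ i j, Arc u i j → 0 ≤ z.pay i j
  invBpb_nonneg : ∀ i, 0 ≤ z.invBpb i
  pay_arc : ∀ i j, ¬ Arc u i j → z.pay i j = 0

/-- The feasible polyhedron. -/
def feasibleSet {A : Type*} [Fintype A] (u : A → A → ℝ) : Set (Vars A) := {z | IsFeasible u z}

/-- The relative entropy term `p log (p / b)` for `p, b ≥ 0`, equal to `+∞` for `b = 0 < p` and to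
`0` for `p = 0`. -/
noncomputable def relEntropy (p b : ℝ) : EReal :=
  open Classical in if b = 0 ∧ p ≠ 0 then ⊤ else ((p * Real.log (p / b) : ℝ) : EReal)

/-- The objective function `∑ p_i log (p_i / β_i) - ∑_{ij ∈ E} y_ij log u_ij`. -/
noncomputable def objective {A : Type*} [Fintype A] (u : A → A → ℝ) (z : Vars A) : EReal :=
  ∑ i, relEntropy (z.price i) (z.invBpb i) -
    ((∑ i, ∑ j with Arc u i j, z.pay i j * Real.log (u i j) : ℝ) : EReal)

/-- The program is convex: its feasible region is convex and the (extended real valued) objective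
is convex there. -/
def IsConvexProgram {A : Type*} [Fintype A] (u : A → A → ℝ) : Prop :=
  Convex ℝ (feasibleSet u) ∧
    ∀ z ∈ feasibleSet u, ∀ w ∈ feasibleSet u, ∀ a b : ℝ, 0 ≤ a → 0 ≤ b → a + b = 1 →
      objective u (a • z + b • w) ≤ (a : EReal) * objective u z + (b : EReal) * objective u w

/-- Optimal solutions of the convex program. -/
def IsOptimal {A : Type*} [Fintype A] (u : A → A → ℝ) (z : Vars A) : Prop :=
  z ∈ feasibleSet u ∧ ∀ w ∈ feasibleSet u, objective u z ≤ objective u w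

/-- The bitsize `⌈log₂ |a|⌉ + ⌈log₂ b⌉` of a fraction `a / b` in lowest terms (`0` for `0`). -/
def bitsize (q : ℚ) : ℕ := Nat.clog 2 q.num.natAbs + Nat.clog 2 q.den

/-- The size of a rational instance: number of agents, number of arcs, and the bitsizes of the
utilities on the arcs. -/
def inputSize {A : Type*} [Fintype A] (u : A → A → ℚ) : ℕ :=
  Fintype.card A + ∑ i, ∑ j with 0 < u i j, (1 + bitsize (u i j))

/-- The total bitsize of rational prices and allocations. -/
def outputSize {A : Type*} [Fintype A] (p : A → ℚ) (x : A → A → ℚ) : ℕ :=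
  ∑ i, bitsize (p i) + ∑ i, ∑ j, bitsize (x i j)

end ArrowDebreu

/-! On a feasible point with all β_i > 0 the balance equations turn the objective into ∑ y_ij
log(p_j / (u_ij β_i)) (`realObjective_eq_sum`). Every term is nonnegative by u_ij β_i ≤ p_j. So the
value is at least 0, and it is 0 exactly when money flows only along arcs with u_ij β_i = p_j. Then
1/β_i is the best bang-per-buck of agent i, and the point is an equilibrium. Convexity of the
objective is joint convexity of relative entropy.

A minimizer has value 0 because the program is self-dual. Farkas' lemma gives multipliers a, b for
inflow and outflow, τ for p ≥ 1 and w for u_ij β_i ≤ p_j. The objective is homogeneous of degree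
one, so its value at the minimizer is ∑ τ_i. Stationarity in y says u_ij e^{b_i} ≤ e^{-a_j}, so
e^{-a} and e^{b} act as prices and inverse bang-per-buck values. Testing stationarity against them,
together with log t ≤ t - 1, forces τ = 0 (`realObjective_eq_zero_of_minimal`).

A minimizer exists by compactness when every arc lies on a closed walk: each component can be
rescaled to minimum price 1, and a bound on the objective then bounds all variables
(`exists_realObjective_eq_zero_of_closed`). In general, arcs between components obstruct this
rescaling. They are first deleted, and the components are afterwards glued by price factors that
grow fast enough along the deleted arcs (`exists_objective_nonpos`). This also proves feasibility
under (⋆). Conversely, flow in a circulation never leaves a strongly connected component, which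
gives (⋆).

Value 0 is a condition on tight constraints alone, so it survives the passage to a vertex of the
polyhedron (`exists_optimal_vertex`). A vertex of a rational polyhedron has polynomial bitsize by
Cramer's rule. -/

namespace ArrowDebreu

/-! ### Farkas' lemma and vertices of polyhedra -/

section Polyhedra

variable {V : Type*} [AddCommGroup V] [Module ℝ V]

/-- **Farkas' lemma** for finitely many linear functionals on a real vector space. -/
theorem farkas_finset {ι : Type*} [DecidableEq ι] (s : Finset ι) :
    ∀ (φ : ι → V →ₗ[ℝ] ℝ) (c : V →ₗ[ℝ] ℝ),
      (∀ d, (∀ r ∈ s, 0 ≤ φ r d) → 0 ≤ c d) →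
      ∃ l : ι → ℝ, (∀ r, 0 ≤ l r) ∧ ∀ d, c d = ∑ r ∈ s, l r * φ r d := by
  induction s using Finset.induction_on with
  | empty =>
    intro φ c h
    refine ⟨fun _ => 0, fun _ => le_rfl, fun d => ?_⟩
    have h1 := h d (by simp)
    have h2 := h (-d) (by simp)
    rw [map_neg] at h2
    simp only [Finset.sum_empty]
    linarith
  | insert r₀ s hr₀ ih =>
    intro φ c h
    by_cases hc : ∀ d, (∀ r ∈ s, 0 ≤ φ r d) → 0 ≤ c d
    · obtain ⟨l, hl, hcl⟩ := ih φ c hc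
      refine ⟨fun r => if r = r₀ then 0 else l r, fun r => ?_, fun d => ?_⟩
      · dsimp only
        split_ifs
        exacts [le_rfl, hl r]
      · rw [Finset.sum_insert hr₀, hcl d]
        simp only [if_true, zero_mul, zero_add]
        refine Finset.sum_congr rfl fun r hr => ?_
        rw [if_neg (ne_of_mem_of_not_mem hr hr₀)]
    · push Not at hc
      obtain ⟨d₁, hd₁, hcd₁⟩ := hc
      have hneg : φ r₀ d₁ < 0 := by
        by_contra hge
        push Not at hge
        refine absurd (h d₁ fun r hr => ?_) (not_le.2 hcd₁)
        rcases Finset.mem_insert.1 hr with rfl | hr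
        exacts [hge, hd₁ r hr]
      set k : ℝ := -(φ r₀ d₁) with hk
      have hkpos : 0 < k := by linarith
      set d₀ : V := k⁻¹ • d₁ with hd₀
      have e0 : φ r₀ d₀ = -1 := by
        rw [hd₀, map_smul, smul_eq_mul]
        field_simp
        linarith
      have es : ∀ r ∈ s, 0 ≤ φ r d₀ := fun r hr => by
        rw [hd₀, map_smul, smul_eq_mul]
        have := hd₁ r hr
        positivity
      have ec : c d₀ < 0 := by
        rw [hd₀, map_smul, smul_eq_mul]
        exact mul_neg_of_pos_of_neg (by positivity) hcd₁
      -- These are the functionals composed with the projection d ↦ d + φ r₀ d • d₀ onto the kernel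
      -- of φ r₀, so the constraint r₀ holds automatically and the induction hypothesis applies to
      -- s.
      obtain ⟨l, hl, hcl⟩ := ih (fun r => φ r + φ r d₀ • φ r₀) (c + c d₀ • φ r₀) (by
        intro d hd
        have := h (d + φ r₀ d • d₀) (by
          intro r hr
          rcases Finset.mem_insert.1 hr with rfl | hr
          · simp [e0]
          · have := hd r hr
            simp only [LinearMap.add_apply, LinearMap.smul_apply, smul_eq_mul] at this
            simp only [map_add, map_smul, smul_eq_mul]
            linarith)
        simp only [map_add, map_smul, smul_eq_mul] at this
        simp only [LinearMap.add_apply, LinearMap.smul_apply, smul_eq_mul]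
        linarith)
      refine ⟨fun r => if r = r₀ then ∑ r ∈ s, l r * φ r d₀ - c d₀ else l r,
        fun r => ?_, fun d => ?_⟩
      · dsimp only
        split_ifs
        · have : 0 ≤ ∑ r ∈ s, l r * φ r d₀ :=
            Finset.sum_nonneg fun r hr => mul_nonneg (hl r) (es r hr)
          linarith
        · exact hl r
      · have h1 := hcl d
        simp only [LinearMap.add_apply, LinearMap.smul_apply, smul_eq_mul] at h1
        rw [Finset.sum_insert hr₀]
        simp only [if_true]
        have h2 : ∑ r ∈ s, (if r = r₀ then ∑ r ∈ s, l r * φ r d₀ - c d₀ else l r) * φ r d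
            = ∑ r ∈ s, l r * φ r d :=
          Finset.sum_congr rfl fun r hr => by rw [if_neg (ne_of_mem_of_not_mem hr hr₀)]
        have h3 : ∑ r ∈ s, l r * (φ r d + φ r d₀ * φ r₀ d)
            = ∑ r ∈ s, l r * φ r d + (∑ r ∈ s, l r * φ r d₀) * φ r₀ d := by
          rw [Finset.sum_mul, ← Finset.sum_add_distrib]
          exact Finset.sum_congr rfl fun r _ => by ring
        rw [h2]
        linarith

/-- Moving from a point of a polyhedron in a direction that does not violate the tight constraints
stays in the polyhedron for a while. -/
theorem eventually_mem_polyhedron {R : Type*} [Finite R] (φ : R → V →ₗ[ℝ] ℝ) (c : R → ℝ) {x d : V}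
    (hx : ∀ r, c r ≤ φ r x) (hd : ∀ r, φ r x = c r → 0 ≤ φ r d) :
    ∀ᶠ t in nhdsWithin (0 : ℝ) (Set.Ioi 0), ∀ r, c r ≤ φ r (x + t • d) := by
  rw [Filter.eventually_all]
  intro r
  by_cases hr : φ r x = c r
  · filter_upwards [self_mem_nhdsWithin] with t ht
    have := mul_nonneg (le_of_lt (Set.mem_Ioi.1 ht)) (hd r hr)
    simp only [map_add, map_smul, smul_eq_mul]
    linarith
  · have hlt : c r < φ r x := lt_of_le_of_ne (hx r) (Ne.symm hr)
    have hcont : Filter.Tendsto (fun t : ℝ => φ r (x + t • d)) (nhds 0) (nhds (φ r x)) := by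
      have : Continuous fun t : ℝ => φ r x + t * φ r d := by fun_prop
      have := this.tendsto 0
      simpa [map_add, map_smul] using this
    have := (hcont.eventually (lt_mem_nhds hlt)).filter_mono
      (nhdsWithin_le_nhds (s := Set.Ioi (0 : ℝ)))
    filter_upwards [this] with t ht using ht.le

/-- If the tight constraints are constant along `d` and some constraint decreases along `d`, then one
can move along `d` up to the first constraint that becomes tight. -/
theorem exists_step_to_new_tight {R : Type*} [Finite R] (φ : R → V →ₗ[ℝ] ℝ) (c : R → ℝ) {x d : V}
    (hx : ∀ r, c r ≤ φ r x) (hd : ∀ r, φ r x = c r → φ r d = 0) {r₁ : R} (hr₁ : φ r₁ d < 0) :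
    ∃ x', (∀ r, c r ≤ φ r x') ∧ (∀ r, φ r x = c r → φ r x' = c r) ∧
      ∃ r, φ r x' = c r ∧ φ r x ≠ c r := by
  have : Nonempty {r : R // φ r d < 0} := ⟨⟨r₁, hr₁⟩⟩
  -- Ratio test: the step length is the smallest slack divided by rate of decrease, over the
  -- constraints that decrease along d.
  obtain ⟨⟨r₂, hr₂⟩, hmin⟩ := Finite.exists_min
    (fun r : {r : R // φ r d < 0} => (φ r x - c r) / -(φ r d))
  set t : ℝ := (φ r₂ x - c r₂) / -(φ r₂ d) with ht
  have ht0 : 0 ≤ t := div_nonneg (by linarith [hx r₂]) (by linarith)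
  refine ⟨x + t • d, fun r => ?_, fun r hr => ?_, r₂, ?_, fun h => ?_⟩
  · simp only [map_add, map_smul, smul_eq_mul]
    rcases lt_or_ge (φ r d) 0 with h | h
    · have := hmin ⟨r, h⟩
      dsimp only at this
      rw [le_div_iff₀ (by linarith)] at this
      linarith
    · have := mul_nonneg ht0 h
      linarith [hx r]
  · simp [map_add, map_smul, hd r hr, hr]
  · simp only [map_add, map_smul, smul_eq_mul]
    have : t * -(φ r₂ d) = φ r₂ x - c r₂ := div_mul_cancel₀ _ (by linarith)
    linarith
  · exact absurd (hd r₂ h) (ne_of_lt hr₂)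

/-- In a polyhedron without lines every point can be moved, keeping its tight constraints tight, to
a point that is determined by its tight constraints. -/
theorem exists_vertex_of_mem {R : Type*} [Finite R] (φ : R → V →ₗ[ℝ] ℝ) (c : R → ℝ)
    (hφ : ∀ d, (∀ r, φ r d = 0) → d = 0) {x₀ : V} (hx₀ : ∀ r, c r ≤ φ r x₀) :
    ∃ x, (∀ r, c r ≤ φ r x) ∧ (∀ r, φ r x₀ = c r → φ r x = c r) ∧
      ∀ d, (∀ r, φ r x = c r → φ r d = 0) → d = 0 := by
  induction hn : {r | φ r x₀ ≠ c r}.ncard using Nat.strong_induction_on generalizing x₀ with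
  | _ n ih =>
    by_cases hd : ∀ d, (∀ r, φ r x₀ = c r → φ r d = 0) → d = 0
    · exact ⟨x₀, hx₀, fun _ h => h, hd⟩
    · push Not at hd
      obtain ⟨d, hd, hd0⟩ := hd
      obtain ⟨r₁, hr₁⟩ : ∃ r, φ r d ≠ 0 := by
        by_contra! h
        exact hd0 (hφ d h)
      -- The tight constraints vanish on both d and -d, so the sign may be chosen to make φ r₁
      -- decrease. The step then lowers the number of slack constraints, the induction variable.
      obtain ⟨e, he, hre⟩ : ∃ e, (∀ r, φ r x₀ = c r → φ r e = 0) ∧ φ r₁ e < 0 := by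
        rcases lt_or_gt_of_ne hr₁ with h | h
        · exact ⟨d, hd, h⟩
        · exact ⟨-d, fun r hr => by simp [hd r hr], by simpa using h⟩
      obtain ⟨x', h1, h2, r, h3, h4⟩ := exists_step_to_new_tight φ c hx₀ he hre
      obtain ⟨x, hx, ht, hk⟩ := ih _ (by
        rw [← hn]
        have hsub : {r | φ r x' ≠ c r} ⊆ {r | φ r x₀ ≠ c r} := fun r hr h => hr (h2 r h)
        exact Set.ncard_lt_ncard ((Set.ssubset_iff_of_subset hsub).2
          ⟨r, h4, fun h => h h3⟩) (Set.toFinite _)) h1 rfl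
      exact ⟨x, hx, fun r hr => ht r (h2 r hr), hk⟩

/-- A point of a polyhedron that is determined by its tight constraints is an extreme point. -/
theorem mem_extremePoints_of_tight {R : Type*} (φ : R → V →ₗ[ℝ] ℝ) (c : R → ℝ) {x : V}
    (hx : ∀ r, c r ≤ φ r x) (hk : ∀ d, (∀ r, φ r x = c r → φ r d = 0) → d = 0) :
    x ∈ {z | ∀ r, c r ≤ φ r z}.extremePoints ℝ := by
  rw [mem_extremePoints_iff_left]
  refine ⟨hx, fun x₁ h₁ x₂ h₂ hseg => ?_⟩
  obtain ⟨a, b, ha, hb, hab, rfl⟩ := hseg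
  -- At a tight constraint the nonnegative slacks of x₁ and x₂ average to zero, so both vanish, and
  -- the difference lies in the kernel of all tight constraints.
  have := hk (x₁ - (a • x₁ + b • x₂)) (fun r hr => ?_)
  · exact sub_eq_zero.1 this
  · simp only [map_add, map_smul, smul_eq_mul, map_sub] at hr ⊢
    have e1 : 0 ≤ a * (φ r x₁ - c r) := mul_nonneg ha.le (by linarith [h₁ r])
    have e2 : 0 ≤ b * (φ r x₂ - c r) := mul_nonneg hb.le (by linarith [h₂ r])
    have e3 : a * (φ r x₁ - c r) + b * (φ r x₂ - c r) = 0 := by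
      linear_combination hr - c r * hab
    have e4 : a * (φ r x₁ - c r) = 0 := by linarith
    have e5 : φ r x₁ - c r = 0 := by
      rcases mul_eq_zero.1 e4 with h | h
      exacts [absurd h ha.ne', h]
    linarith

end Polyhedra

/-! ### Size of solutions of integral linear systems -/

section Cramer

open scoped Nat
open Matrix

/-- The unique solution of an integral linear system is a vector of fractions with a common
denominator, and numerators and denominator are bounded in terms of the coefficients. -/
theorem exists_int_fractions_of_unique_solution {R ι : Type*} [Fintype R] [Fintype ι]
    (M : Matrix R ι ℤ) (c : R → ℤ) (B : ℕ) (hM : ∀ r k, |M r k| ≤ B) (hc : ∀ r, |c r| ≤ B)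
    (x : ι → ℝ) (hx : ∀ r, ∑ k, (M r k : ℝ) * x k = c r)
    (hk : ∀ d : ι → ℝ, (∀ r, ∑ k, (M r k : ℝ) * d k = 0) → d = 0) :
    ∃ (D : ℤ) (N : ι → ℤ), D ≠ 0 ∧ (∀ k, x k = N k / D) ∧
      D.natAbs ≤ (Fintype.card ι)! * (Fintype.card R * B ^ 2) ^ Fintype.card ι ∧
      ∀ k, (N k).natAbs ≤ (Fintype.card ι)! * (Fintype.card R * B ^ 2) ^ Fintype.card ι := by
  classical
  -- The normal equations form a square system, nonsingular because M has trivial kernel. No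
  -- independent rows have to be selected, at the price of entries up to |R| B² instead of B.
  set G : Matrix ι ι ℤ := Mᵀ * M with hG
  set v : ι → ℤ := Mᵀ *ᵥ c with hv
  set MR : Matrix R ι ℝ := M.map (Int.castRingHom ℝ) with hMR
  have hGR : G.map (Int.castRingHom ℝ) = MRᵀ * MR := by
    rw [hG, Matrix.map_mul, Matrix.transpose_map]
  have hMRv : ∀ d : ι → ℝ, MR *ᵥ d = fun r => ∑ k, (M r k : ℝ) * d k := fun d => rfl
  have hdetR : (MRᵀ * MR).det ≠ 0 := by
    intro h
    obtain ⟨d, hd0, hd⟩ := Matrix.exists_mulVec_eq_zero_iff.2 h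
    refine hd0 (hk d fun r => ?_)
    have h1 : MR *ᵥ d ⬝ᵥ MR *ᵥ d = 0 := by
      rw [Matrix.dotProduct_mulVec, Matrix.vecMul_mulVec, ← Matrix.mulVec_transpose,
        Matrix.transpose_mul, Matrix.transpose_transpose, hd, zero_dotProduct]
    exact congrFun (dotProduct_self_eq_zero.1 h1) r
  have hdet : ((G.det : ℤ) : ℝ) = (MRᵀ * MR).det := by
    rw [← hGR]
    exact (Int.castRingHom ℝ).map_det G
  have hsol : (MRᵀ * MR) *ᵥ x = fun k => (v k : ℝ) := by
    rw [← Matrix.mulVec_mulVec, hMRv, funext hx]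
    ext k
    simp [hv, hMR, Matrix.mulVec, dotProduct]
  have hcr : ∀ k, ((G.cramer v k : ℤ) : ℝ) = (G.det : ℝ) * x k := by
    intro k
    have h1 : (MRᵀ * MR).cramer (fun k => (v k : ℝ)) = (MRᵀ * MR).det • x := by
      rw [← hsol, Matrix.cramer_eq_adjugate_mulVec, Matrix.mulVec_mulVec, Matrix.adjugate_mul,
        Matrix.smul_mulVec, Matrix.one_mulVec]
    have h2 := congrFun h1 k
    rw [Pi.smul_apply, smul_eq_mul, ← hdet] at h2
    rw [← h2, Matrix.cramer_apply, Matrix.cramer_apply, ← hGR]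
    have := (Int.castRingHom ℝ).map_det (G.updateCol k v)
    rw [RingHom.mapMatrix_apply, Matrix.map_updateCol] at this
    exact this
  have hsum : ∀ f g : R → ℤ, (∀ r, |f r| ≤ B) → (∀ r, |g r| ≤ B) →
      |∑ r, f r * g r| ≤ ((Fintype.card R * B ^ 2 : ℕ) : ℤ) := by
    intro f g hf hg
    calc |∑ r, f r * g r| ≤ ∑ r, |f r * g r| := Finset.abs_sum_le_sum_abs _ _
      _ ≤ ∑ _r : R, ((B : ℤ) ^ 2) := Finset.sum_le_sum fun r _ => by
        rw [abs_mul, sq]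
        exact mul_le_mul (hf r) (hg r) (abs_nonneg _) (by positivity)
      _ = _ := by simp
  have hGb : ∀ i j, |G i j| ≤ ((Fintype.card R * B ^ 2 : ℕ) : ℤ) := fun i j => by
    rw [hG, Matrix.mul_apply]
    exact hsum _ _ (fun r => hM r i) (fun r => hM r j)
  have hvb : ∀ i, |v i| ≤ ((Fintype.card R * B ^ 2 : ℕ) : ℤ) := fun i =>
    hsum _ _ (fun r => hM r i) hc
  have hdetb : ∀ H : Matrix ι ι ℤ, (∀ i j, |H i j| ≤ ((Fintype.card R * B ^ 2 : ℕ) : ℤ)) →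
      H.det.natAbs ≤ (Fintype.card ι)! * (Fintype.card R * B ^ 2) ^ Fintype.card ι := by
    intro H hH
    have := Matrix.det_le (abv := AbsoluteValue.abs) hH
    rw [AbsoluteValue.abs_apply, nsmul_eq_mul, Int.abs_eq_natAbs] at this
    exact_mod_cast this
  refine ⟨G.det, G.cramer v, fun h => hdetR (by rw [← hdet, h, Int.cast_zero]), fun k => ?_,
    hdetb _ hGb, fun k => ?_⟩
  · rw [hcr, mul_div_cancel_left₀]
    rw [hdet]
    exact hdetR
  · rw [Matrix.cramer_apply]
    refine hdetb _ fun i j => ?_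
    rw [Matrix.updateCol_apply]
    split_ifs
    exacts [hvb i, hGb i j]

end Cramer

variable {A : Type*}

/-! ### Balance equations over all pairs of agents -/

section Feasibility

variable [Fintype A]

theorem sum_filter_arc_eq {u : A → A → ℝ} {f : A → A → ℝ} (hf : ∀ i j, ¬ Arc u i j → f i j = 0)
    (i : A) : ∑ j with Arc u i j, f i j = ∑ j, f i j :=
  Finset.sum_filter_of_ne fun j _ h => not_not.1 fun hn => h (hf i j hn)

theorem sum_filter_arc_eq' {u : A → A → ℝ} {f : A → A → ℝ} (hf : ∀ i j, ¬ Arc u i j → f i j = 0)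
    (j : A) : ∑ i with Arc u i j, f i j = ∑ i, f i j :=
  Finset.sum_filter_of_ne fun i _ h => not_not.1 fun hn => h (hf i j hn)

variable {u : A → A → ℝ} {z : Vars A}

namespace IsFeasible

theorem sum_in (h : IsFeasible u z) (j : A) : ∑ i, z.pay i j = z.price j := by
  rw [← h.inflow j, sum_filter_arc_eq' h.pay_arc]

theorem sum_out (h : IsFeasible u z) (i : A) : ∑ j, z.pay i j = z.price i := by
  rw [← h.outflow i, sum_filter_arc_eq h.pay_arc]

theorem pay_nonneg' (h : IsFeasible u z) (i j : A) : 0 ≤ z.pay i j := by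
  by_cases hij : Arc u i j
  exacts [h.pay_nonneg i j hij, (h.pay_arc i j hij).ge]

theorem price_pos (h : IsFeasible u z) (i : A) : 0 < z.price i :=
  lt_of_lt_of_le one_pos (h.one_le_price i)

theorem arc_of_pay_pos (h : IsFeasible u z) {i j : A} (hij : 0 < z.pay i j) : Arc u i j :=
  not_not.1 fun hn => hij.ne' (h.pay_arc i j hn)

end IsFeasible

theorem isFeasible_of_sums (hin : ∀ j, ∑ i, z.pay i j = z.price j)
    (hout : ∀ i, ∑ j, z.pay i j = z.price i)
    (hbpb : ∀ i j, Arc u i j → u i j * z.invBpb i ≤ z.price j) (hp : ∀ i, 1 ≤ z.price i)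
    (hy : ∀ i j, 0 ≤ z.pay i j) (hβ : ∀ i, 0 ≤ z.invBpb i)
    (hna : ∀ i j, ¬ Arc u i j → z.pay i j = 0) : IsFeasible u z where
  inflow j := by rw [sum_filter_arc_eq' hna, hin]
  outflow i := by rw [sum_filter_arc_eq hna, hout]
  bpb := hbpb
  one_le_price := hp
  pay_nonneg i j _ := hy i j
  invBpb_nonneg := hβ
  pay_arc := hna

end Feasibility

/-! ### The feasible region as a polyhedron without lines -/

section Rows

/-- The linear functional `y i j`. -/
def payFun (i j : A) : Vars A →ₗ[ℝ] ℝ :=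
  LinearMap.proj j ∘ₗ LinearMap.proj i ∘ₗ LinearMap.fst ℝ (A → A → ℝ) ((A → ℝ) × (A → ℝ))

/-- The linear functional `p i`. -/
def priceFun (i : A) : Vars A →ₗ[ℝ] ℝ :=
  LinearMap.proj i ∘ₗ LinearMap.fst ℝ (A → ℝ) (A → ℝ) ∘ₗ LinearMap.snd ℝ (A → A → ℝ) _

/-- The linear functional `β i`. -/
def invBpbFun (i : A) : Vars A →ₗ[ℝ] ℝ :=
  LinearMap.proj i ∘ₗ LinearMap.snd ℝ (A → ℝ) (A → ℝ) ∘ₗ LinearMap.snd ℝ (A → A → ℝ) _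

@[simp] theorem payFun_apply (i j : A) (z : Vars A) : payFun i j z = z.pay i j := rfl

@[simp] theorem priceFun_apply (i : A) (z : Vars A) : priceFun i z = z.price i := rfl

@[simp] theorem invBpbFun_apply (i : A) (z : Vars A) : invBpbFun i z = z.invBpb i := rfl

/-- Index set of the inequalities that describe the feasible polyhedron: inflow and outflow (two
inequalities each), prices, inverse bang-per-buck values, bang-per-buck bounds, nonnegativity of the
payments, and vanishing of the payments off the arcs. -/
abbrev Row (A : Type*) : Type _ :=
  (A ⊕ A) ⊕ (A ⊕ A) ⊕ (A ⊕ A) ⊕ (A × A) ⊕ (A × A) ⊕ (A × A)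

variable [Fintype A]

/-- Left hand sides of the inequalities `rowConst r ≤ rowFun u r z`. -/
noncomputable def rowFun (u : A → A → ℝ) : Row A → Vars A →ₗ[ℝ] ℝ
  | .inl (.inl j) => ∑ i, payFun i j - priceFun j
  | .inl (.inr j) => priceFun j - ∑ i, payFun i j
  | .inr (.inl (.inl i)) => ∑ j, payFun i j - priceFun i
  | .inr (.inl (.inr i)) => priceFun i - ∑ j, payFun i j
  | .inr (.inr (.inl (.inl i))) => priceFun i
  | .inr (.inr (.inl (.inr i))) => invBpbFun i
  | .inr (.inr (.inr (.inl ij))) => priceFun ij.2 - u ij.1 ij.2 • invBpbFun ij.1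
  | .inr (.inr (.inr (.inr (.inl ij)))) => payFun ij.1 ij.2
  -- Off the arcs this is -y ≥ 0, which with y ≥ 0 forces y = 0; on the arcs it is the trivial 0 ≥
  -- 0.
  | .inr (.inr (.inr (.inr (.inr ij)))) => (if Arc u ij.1 ij.2 then 0 else -1 : ℝ) • payFun ij.1 ij.2

/-- Right hand sides of the inequalities that describe the feasible polyhedron. -/
def rowConst {A : Type*} : Row A → ℤ
  | .inr (.inr (.inl (.inl _))) => 1
  | _ => 0

variable {u : A → A → ℝ} {z : Vars A}

/-- The bang-per-buck rows range over all pairs. Off the arcs u vanishes, so the extra rows read 0 ≤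
p_j, which already follows from p_j ≥ 1. -/
theorem isFeasible_iff_forall_row (hu : ∀ i j, 0 ≤ u i j) :
    IsFeasible u z ↔ ∀ r, (rowConst r : ℝ) ≤ rowFun u r z := by
  constructor
  · rintro h ((j | j) | (i | i) | (i | i) | ij | ij | ij)
    · simp [rowConst, rowFun, h.sum_in]
    · simp [rowConst, rowFun, h.sum_in]
    · simp [rowConst, rowFun, h.sum_out]
    · simp [rowConst, rowFun, h.sum_out]
    · simpa [rowConst, rowFun] using h.one_le_price i
    · simpa [rowConst, rowFun] using h.invBpb_nonneg i
    · by_cases hij : Arc u ij.1 ij.2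
      · simpa [rowConst, rowFun] using h.bpb _ _ hij
      · have : u ij.1 ij.2 = 0 := le_antisymm (not_lt.1 hij) (hu _ _)
        simpa [rowConst, rowFun, this] using (h.price_pos ij.2).le
    · simpa [rowConst, rowFun] using h.pay_nonneg' ij.1 ij.2
    · by_cases hij : Arc u ij.1 ij.2
      · simp [rowConst, rowFun, hij]
      · simp [rowConst, rowFun, hij, h.pay_arc _ _ hij]
  · intro h
    refine isFeasible_of_sums (fun j => ?_) (fun i => ?_) (fun i j _ => ?_) (fun i => ?_)
      (fun i j => ?_) (fun i => ?_) (fun i j hij => ?_)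
    · have h1 := h (.inl (.inl j))
      have h2 := h (.inl (.inr j))
      simp [rowConst, rowFun] at h1 h2
      linarith
    · have h1 := h (.inr (.inl (.inl i)))
      have h2 := h (.inr (.inl (.inr i)))
      simp [rowConst, rowFun] at h1 h2
      linarith
    · have := h (.inr (.inr (.inr (.inl (i, j)))))
      simpa [rowConst, rowFun] using this
    · have := h (.inr (.inr (.inl (.inl i))))
      simpa [rowConst, rowFun] using this
    · have := h (.inr (.inr (.inr (.inr (.inl (i, j))))))
      simpa [rowConst, rowFun] using this
    · have := h (.inr (.inr (.inl (.inr i))))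
      simpa [rowConst, rowFun] using this
    · have h1 := h (.inr (.inr (.inr (.inr (.inl (i, j))))))
      have h2 := h (.inr (.inr (.inr (.inr (.inr (i, j))))))
      simp [rowConst, rowFun, hij] at h1 h2
      linarith

theorem feasibleSet_eq (hu : ∀ i j, 0 ≤ u i j) :
    feasibleSet u = {z | ∀ r, (rowConst r : ℝ) ≤ rowFun u r z} :=
  Set.ext fun _ => isFeasible_iff_forall_row hu

theorem convex_feasibleSet (hu : ∀ i j, 0 ≤ u i j) : Convex ℝ (feasibleSet u) := by
  rw [feasibleSet_eq hu, Set.ofPred_forall]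
  exact convex_iInter fun r => convex_halfSpace_ge (rowFun u r).isLinear _

/-- The feasible polyhedron contains no line. -/
theorem eq_zero_of_forall_rowFun_eq_zero {d : Vars A} (h : ∀ r, rowFun u r d = 0) : d = 0 := by
  refine Prod.ext (funext₂ fun i j => ?_) (Prod.ext (funext fun i => ?_) (funext fun i => ?_))
  · exact h (.inr (.inr (.inr (.inr (.inl (i, j))))))
  · exact h (.inr (.inr (.inl (.inl i))))
  · exact h (.inr (.inr (.inl (.inr i))))

end Rows

/-! ### The objective: nonnegativity, zeros, convexity, equilibria -/

section Objective

variable [Fintype A]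

/-- The objective at points with positive `β`, as a real number. -/
noncomputable def realObjective (u : A → A → ℝ) (z : Vars A) : ℝ :=
  ∑ i, z.price i * Real.log (z.price i / z.invBpb i) - ∑ i, ∑ j, z.pay i j * Real.log (u i j)

theorem ereal_sum_ne_bot {ι : Type*} (s : Finset ι) {f : ι → EReal} (hf : ∀ i ∈ s, f i ≠ ⊥) :
    ∑ i ∈ s, f i ≠ ⊥ :=
  Finset.sum_induction f (fun x => x ≠ ⊥) (fun _ _ ha hb => EReal.add_ne_bot_iff.2 ⟨ha, hb⟩)
    EReal.zero_ne_bot hf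

theorem relEntropy_ne_bot (p b : ℝ) : relEntropy p b ≠ ⊥ := by
  unfold relEntropy
  split_ifs
  exacts [top_ne_bot, EReal.coe_ne_bot _]

variable {u : A → A → ℝ} {z w : Vars A}

theorem objective_eq_top (h : IsFeasible u z) {i : A} (hi : z.invBpb i = 0) :
    objective u z = ⊤ := by
  classical
  have h1 : relEntropy (z.price i) (z.invBpb i) = ⊤ := if_pos ⟨hi, (h.price_pos i).ne'⟩
  rw [objective, ← Finset.add_sum_erase _ _ (Finset.mem_univ i), h1,
    EReal.top_add_of_ne_bot (ereal_sum_ne_bot _ fun _ _ => relEntropy_ne_bot _ _)]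
  exact EReal.top_sub_coe _

theorem objective_eq_coe (h : IsFeasible u z) (hβ : ∀ i, z.invBpb i ≠ 0) :
    objective u z = (realObjective u z : ℝ) := by
  have h1 : ∀ i, relEntropy (z.price i) (z.invBpb i)
      = ((z.price i * Real.log (z.price i / z.invBpb i) : ℝ) : EReal) :=
    fun i => if_neg fun hn => hβ i hn.1
  have h2 : ∀ i, ∑ j with Arc u i j, z.pay i j * Real.log (u i j)
      = ∑ j, z.pay i j * Real.log (u i j) := fun i =>
    sum_filter_arc_eq (f := fun i j => z.pay i j * Real.log (u i j))
      (fun i j hn => by simp only [h.pay_arc i j hn, zero_mul]) i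
  have h3 : ∀ f : A → ℝ, ∑ i, (f i : EReal) = ((∑ i, f i : ℝ) : EReal) := fun f =>
    (map_sum (⟨⟨Real.toEReal, EReal.coe_zero⟩, EReal.coe_add⟩ : ℝ →+ EReal) f Finset.univ).symm
  simp only [objective, h1, h2, h3, realObjective, EReal.coe_sub]

theorem objective_cases (h : IsFeasible u z) :
    (objective u z = ⊤ ∧ ∃ i, z.invBpb i = 0) ∨
      ((∀ i, 0 < z.invBpb i) ∧ objective u z = (realObjective u z : ℝ)) := by
  by_cases hz : ∃ i, z.invBpb i = 0
  · obtain ⟨i, hi⟩ := hz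
    exact Or.inl ⟨objective_eq_top h hi, i, hi⟩
  · push Not at hz
    exact Or.inr ⟨fun i => lt_of_le_of_ne (h.invBpb_nonneg i) (hz i).symm, objective_eq_coe h hz⟩

/-- Inflow equations distribute p_j log p_j, and outflow equations distribute p_i log β_i, over the
payments. This makes the objective a payment-weighted sum of the logarithmic gaps in u_ij β_i ≤ p_j.
-/
theorem realObjective_eq_sum (h : IsFeasible u z) (hβ : ∀ i, 0 < z.invBpb i) :
    realObjective u z = ∑ i, ∑ j,
      z.pay i j * (Real.log (z.price j) - Real.log (z.invBpb i) - Real.log (u i j)) := by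
  have e1 : ∑ i, ∑ j, z.pay i j * Real.log (z.price j) = ∑ j, z.price j * Real.log (z.price j) := by
    rw [Finset.sum_comm]
    exact Finset.sum_congr rfl fun j _ => by rw [← Finset.sum_mul, h.sum_in]
  have e2 : ∑ i, ∑ j, z.pay i j * Real.log (z.invBpb i)
      = ∑ i, z.price i * Real.log (z.invBpb i) :=
    Finset.sum_congr rfl fun i _ => by rw [← Finset.sum_mul, h.sum_out]
  have e3 : ∑ i, z.price i * Real.log (z.price i / z.invBpb i)
      = ∑ i, z.price i * Real.log (z.price i) - ∑ i, z.price i * Real.log (z.invBpb i) := by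
    rw [← Finset.sum_sub_distrib]
    refine Finset.sum_congr rfl fun i _ => ?_
    rw [Real.log_div (h.price_pos i).ne' (hβ i).ne', mul_sub]
  simp only [mul_sub, Finset.sum_sub_distrib, e1, e2, e3, realObjective]

theorem gap_nonneg (h : IsFeasible u z) (hβ : ∀ i, 0 < z.invBpb i) {i j : A} (hij : Arc u i j) :
    0 ≤ Real.log (z.price j) - Real.log (z.invBpb i) - Real.log (u i j) := by
  have h1 := Real.log_le_log (mul_pos hij (hβ i)) (h.bpb i j hij)
  rw [Real.log_mul (ne_of_gt hij) (hβ i).ne'] at h1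
  linarith

theorem pay_mul_gap_nonneg (h : IsFeasible u z) (hβ : ∀ i, 0 < z.invBpb i) (i j : A) :
    0 ≤ z.pay i j * (Real.log (z.price j) - Real.log (z.invBpb i) - Real.log (u i j)) := by
  by_cases hij : Arc u i j
  · exact mul_nonneg (h.pay_nonneg' i j) (gap_nonneg h hβ hij)
  · rw [h.pay_arc i j hij, zero_mul]

theorem realObjective_nonneg (h : IsFeasible u z) (hβ : ∀ i, 0 < z.invBpb i) :
    0 ≤ realObjective u z := by
  rw [realObjective_eq_sum h hβ]
  exact Finset.sum_nonneg fun i _ => Finset.sum_nonneg fun j _ => pay_mul_gap_nonneg h hβ i j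

/-- No term of the sum is negative, so a bound on the objective bounds each one. This drives both
the equality case and the compactness estimates. -/
theorem pay_mul_gap_le (h : IsFeasible u z) (hβ : ∀ i, 0 < z.invBpb i) (i j : A) :
    z.pay i j * (Real.log (z.price j) - Real.log (z.invBpb i) - Real.log (u i j))
      ≤ realObjective u z := by
  rw [realObjective_eq_sum h hβ]
  have h1 := Finset.single_le_sum (f := fun i => ∑ j, z.pay i j *
    (Real.log (z.price j) - Real.log (z.invBpb i) - Real.log (u i j)))
    (fun i _ => Finset.sum_nonneg fun j _ => pay_mul_gap_nonneg h hβ i j) (Finset.mem_univ i)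
  exact (Finset.single_le_sum (f := fun j => z.pay i j *
    (Real.log (z.price j) - Real.log (z.invBpb i) - Real.log (u i j)))
    (fun j _ => pay_mul_gap_nonneg h hβ i j) (Finset.mem_univ j)).trans h1

/-- The objective vanishes exactly when payments are made only for goods of best bang-per-buck. -/
theorem realObjective_eq_zero_iff (h : IsFeasible u z) (hβ : ∀ i, 0 < z.invBpb i) :
    realObjective u z = 0 ↔ ∀ i j, z.pay i j ≠ 0 → u i j * z.invBpb i = z.price j := by
  constructor
  · intro h0 i j hij
    have hpos := lt_of_le_of_ne (h.pay_nonneg' i j) (Ne.symm hij)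
    have harc := h.arc_of_pay_pos hpos
    have h1 := pay_mul_gap_le h hβ i j
    have h2 := gap_nonneg h hβ harc
    rw [h0] at h1
    have h3 : Real.log (z.price j) - Real.log (z.invBpb i) - Real.log (u i j) = 0 :=
      le_antisymm (nonpos_of_mul_nonpos_right h1 hpos) h2
    refine Real.log_injOn_pos (mul_pos harc (hβ i)) (h.price_pos j) ?_
    rw [Real.log_mul (ne_of_gt harc) (hβ i).ne']
    linarith
  · intro hc
    rw [realObjective_eq_sum h hβ]
    refine Finset.sum_eq_zero fun i _ => Finset.sum_eq_zero fun j _ => ?_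
    by_cases hij : z.pay i j = 0
    · rw [hij, zero_mul]
    · have harc := h.arc_of_pay_pos (lt_of_le_of_ne (h.pay_nonneg' i j) (Ne.symm hij))
      rw [← hc i j hij, Real.log_mul (ne_of_gt harc) (hβ i).ne']
      ring

theorem objective_nonneg (h : IsFeasible u z) : 0 ≤ objective u z := by
  rcases objective_cases h with ⟨h1, -⟩ | ⟨h1, h2⟩
  · rw [h1]
    exact le_top
  · rw [h2]
    exact_mod_cast realObjective_nonneg h h1

theorem objective_nonpos_iff (h : IsFeasible u z) :
    objective u z ≤ 0 ↔
      (∀ i, 0 < z.invBpb i) ∧ ∀ i j, z.pay i j ≠ 0 → u i j * z.invBpb i = z.price j := by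
  rcases objective_cases h with ⟨h1, i, hi⟩ | ⟨h1, h2⟩
  · rw [h1]
    refine ⟨fun hh => absurd hh (by simp), fun hh => absurd (hh.1 i) (by simp [hi])⟩
  · rw [h2, ← realObjective_eq_zero_iff h h1]
    have := realObjective_nonneg h h1
    constructor
    · intro hh
      exact ⟨h1, le_antisymm (by exact_mod_cast hh) this⟩
    · intro hh
      rw [hh.2]
      exact le_rfl

/-- Joint convexity of the relative entropy. -/
theorem mul_log_div_convex {p q b c s t : ℝ} (hp : 0 < p) (hq : 0 < q) (hb : 0 < b) (hc : 0 < c)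
    (hs : 0 < s) (ht : 0 < t) :
    (s * p + t * q) * Real.log ((s * p + t * q) / (s * b + t * c))
      ≤ s * (p * Real.log (p / b)) + t * (q * Real.log (q / c)) := by
  set P := s * p + t * q with hP
  set B := s * b + t * c with hB
  have hP0 : 0 < P := by positivity
  have hB0 : 0 < B := by positivity
  -- This is log t ≤ t - 1 at t = (P/B)/(x/y). In the weighted sum over (p, b) and (q, c) the
  -- correction terms -x and y (P/B) add up to -P + P = 0.
  have key : ∀ x y : ℝ, 0 < x → 0 < y →
      x * Real.log (P / B) ≤ x * Real.log (x / y) - x + y * (P / B) := by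
    intro x y hx hy
    have h1 := Real.log_le_sub_one_of_pos (x := (P / B) / (x / y)) (by positivity)
    rw [Real.log_div (by positivity) (by positivity)] at h1
    have h2 := mul_le_mul_of_nonneg_left h1 hx.le
    have h3 : x * (P / B / (x / y) - 1) = y * (P / B) - x := by
      field_simp
    rw [h3] at h2
    linarith
  have h1 := mul_le_mul_of_nonneg_left (key p b hp hb) hs.le
  have h2 := mul_le_mul_of_nonneg_left (key q c hq hc) ht.le
  have h3 : B * (P / B) = P := mul_div_cancel₀ _ hB0.ne'
  have h4 : P * Real.log (P / B) = s * (p * Real.log (P / B)) + t * (q * Real.log (P / B)) := by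
    rw [hP]; ring
  have h5 : s * (b * (P / B)) + t * (c * (P / B)) = P := by
    rw [← mul_assoc, ← mul_assoc, ← add_mul]
    exact h3
  have h6 : s * p + t * q = P := rfl
  rw [h4]
  linarith

theorem realObjective_convex (hz : IsFeasible u z) (hw : IsFeasible u w)
    (hβz : ∀ i, 0 < z.invBpb i) (hβw : ∀ i, 0 < w.invBpb i) {a b : ℝ} (ha : 0 < a) (hb : 0 < b) :
    realObjective u (a • z + b • w) ≤ a * realObjective u z + b * realObjective u w := by
  have h1 : ∑ i, (a * z.price i + b * w.price i) *
        Real.log ((a * z.price i + b * w.price i) / (a * z.invBpb i + b * w.invBpb i))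
      ≤ a * ∑ i, z.price i * Real.log (z.price i / z.invBpb i)
        + b * ∑ i, w.price i * Real.log (w.price i / w.invBpb i) := by
    rw [Finset.mul_sum, Finset.mul_sum, ← Finset.sum_add_distrib]
    exact Finset.sum_le_sum fun i _ => mul_log_div_convex (hz.price_pos i) (hw.price_pos i) (hβz i)
      (hβw i) ha hb
  have h2 : ∑ i, ∑ j, (a * z.pay i j + b * w.pay i j) * Real.log (u i j)
      = a * ∑ i, ∑ j, z.pay i j * Real.log (u i j)
        + b * ∑ i, ∑ j, w.pay i j * Real.log (u i j) := by
    simp only [Finset.mul_sum, ← Finset.sum_add_distrib]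
    exact Finset.sum_congr rfl fun i _ => Finset.sum_congr rfl fun j _ => by ring
  have h3 : realObjective u (a • z + b • w) = ∑ i, (a * z.price i + b * w.price i) *
        Real.log ((a * z.price i + b * w.price i) / (a * z.invBpb i + b * w.invBpb i))
      - ∑ i, ∑ j, (a * z.pay i j + b * w.pay i j) * Real.log (u i j) := rfl
  rw [h3, h2]
  unfold realObjective
  linarith

theorem isConvexProgram (hu : ∀ i j, 0 ≤ u i j) : IsConvexProgram u := by
  refine ⟨convex_feasibleSet hu, fun z hz w hw a b ha hb hab => ?_⟩
  -- Zero weights are treated apart because 0 * ⊤ = 0 in `EReal`.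
  rcases ha.eq_or_lt with rfl | ha
  · obtain rfl : b = 1 := by linarith
    simp
  rcases hb.eq_or_lt with rfl | hb
  · obtain rfl : a = 1 := by linarith
    simp
  -- Needed because ⊤ + ⊥ = ⊥ in `EReal`.
  have hne : ∀ {c : ℝ} {v : Vars A}, 0 < c → IsFeasible u v → (c : EReal) * objective u v ≠ ⊥ := by
    intro c v hc hv
    refine ne_of_gt (lt_of_lt_of_le EReal.bot_lt_zero ?_)
    exact mul_nonneg (by exact_mod_cast hc.le) (objective_nonneg hv)
  rcases objective_cases hz with ⟨hz1, -⟩ | ⟨hz1, hz2⟩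
  · rw [hz1, EReal.coe_mul_top_of_pos ha, EReal.top_add_of_ne_bot (hne hb hw)]
    exact le_top
  rcases objective_cases hw with ⟨hw1, -⟩ | ⟨hw1, hw2⟩
  · rw [hw1, EReal.coe_mul_top_of_pos hb, EReal.add_top_of_ne_bot (hne ha hz)]
    exact le_top
  have hfeas : IsFeasible u (a • z + b • w) := convex_feasibleSet hu hz hw ha.le hb.le hab
  have hpos : ∀ i, 0 < (a • z + b • w).invBpb i := fun i =>
    add_pos (mul_pos ha (hz1 i)) (mul_pos hb (hw1 i))
  rw [hz2, hw2, objective_eq_coe hfeas fun i => (hpos i).ne']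
  exact_mod_cast realObjective_convex hz hw hz1 hw1 ha hb

/-- Feasible points of objective value at most zero are market equilibria. -/
theorem isEquilibrium_of_objective_nonpos (hu : ∀ i j, 0 ≤ u i j) (h : IsFeasible u z)
    (h0 : objective u z ≤ 0) :
    IsEquilibrium u z.price (fun i j => z.pay i j / z.price j) := by
  obtain ⟨hβ, hc⟩ := (objective_nonpos_iff h).1 h0
  have hbest : ∀ i k, u i k * z.invBpb i ≤ z.price k := by
    intro i k
    by_cases hik : Arc u i k
    · exact h.bpb i k hik
    · rw [le_antisymm (not_lt.1 hik) (hu i k), zero_mul]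
      exact (h.price_pos k).le
  have hcancel : ∀ i j, z.pay i j / z.price j * z.price j = z.pay i j :=
    fun i j => div_mul_cancel₀ _ (h.price_pos j).ne'
  refine ⟨h.price_pos, fun i j => div_nonneg (h.pay_nonneg' i j) (h.price_pos j).le,
    fun i j hij => by simp only [h.pay_arc i j hij, zero_div], fun j => ?_, fun i => ?_,
    fun i b hb hbud => ?_, fun i j hij k => ?_⟩
  · rw [← Finset.sum_div, h.sum_in, div_self (h.price_pos j).ne']
  · simp only [hcancel, h.sum_out]
  -- Weak duality: β_i times the utility of a bundle is at most its cost, with equality for the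
  -- bundle bought at z, which costs exactly the income p_i.
  · refine le_of_mul_le_mul_right ?_ (hβ i)
    calc (∑ j, u i j * b j) * z.invBpb i = ∑ j, b j * (u i j * z.invBpb i) := by
          rw [Finset.sum_mul]
          exact Finset.sum_congr rfl fun j _ => by ring
      _ ≤ ∑ j, b j * z.price j :=
          Finset.sum_le_sum fun j _ => mul_le_mul_of_nonneg_left (hbest i j) (hb j)
      _ ≤ z.price i := hbud
      _ = ∑ j, z.pay i j := (h.sum_out i).symm
      _ = (∑ j, u i j * (z.pay i j / z.price j)) * z.invBpb i := by
          rw [Finset.sum_mul]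
          refine Finset.sum_congr rfl fun j _ => ?_
          by_cases hij : z.pay i j = 0
          · simp [hij]
          · have hp := (h.price_pos j).ne'
            have := hc i j hij
            field_simp
            exact this.symm
  · have hij' : z.pay i j ≠ 0 := fun hn => by simp [hn] at hij
    have e1 : u i j / z.price j = (z.invBpb i)⁻¹ := by
      rw [div_eq_iff (h.price_pos j).ne', ← hc i j hij', mul_comm (u i j),
        inv_mul_cancel_left₀ (hβ i).ne']
    rw [e1, div_le_iff₀ (h.price_pos k), ← div_eq_inv_mul, le_div_iff₀ (hβ i)]
    exact hbest i k

end Objective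

/-! ### Necessity of condition (⋆) -/

section Feasible

variable {u : A → A → ℝ}

/-- In a circulation, an arc that carries flow lies on a closed walk. -/
theorem reflTransGen_of_pay_pos [Fintype A] {z : Vars A} (h : IsFeasible u z) {i j : A} (hij : 0 < z.pay i j) :
    Relation.ReflTransGen (Arc u) j i := by
  classical
  -- No arc leaves the set S of nodes reachable from j, so all payments made by S stay in S. They
  -- already exhaust the total income of S, so nothing flows into S from outside; hence i is in S.
  set S : Finset A := Finset.univ.filter fun k => Relation.ReflTransGen (Arc u) j k with hS
  have hout : ∀ k ∈ S, ∑ l ∈ S, z.pay k l = z.price k := by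
    intro k hk
    rw [← h.sum_out k]
    refine Finset.sum_subset (Finset.subset_univ _) fun l _ hl => h.pay_arc k l fun harc => hl ?_
    rw [hS, Finset.mem_filter] at hk ⊢
    exact ⟨Finset.mem_univ _, hk.2.tail harc⟩
  have hsum : ∑ l ∈ S, ∑ k ∈ Sᶜ, z.pay k l = 0 := by
    have h1 : ∑ l ∈ S, (∑ k ∈ S, z.pay k l + ∑ k ∈ Sᶜ, z.pay k l) = ∑ l ∈ S, z.price l :=
      Finset.sum_congr rfl fun l _ => by rw [Finset.sum_add_sum_compl, h.sum_in]
    rw [Finset.sum_add_distrib, Finset.sum_comm, Finset.sum_congr rfl hout] at h1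
    linarith
  by_contra hn
  have hj : j ∈ S := by simp [hS, Relation.ReflTransGen.refl]
  have hi : i ∈ Sᶜ := by simpa [hS] using hn
  rw [Finset.sum_eq_zero_iff_of_nonneg
    fun l _ => Finset.sum_nonneg fun k _ => h.pay_nonneg' k l] at hsum
  have h2 := hsum j hj
  rw [Finset.sum_eq_zero_iff_of_nonneg fun k _ => h.pay_nonneg' k j] at h2
  exact hij.ne' (h2 i hi)

/-- Since p_i ≥ 1, agent i pays somebody. That arc lies on a closed walk, so the payee is in the
component of i; in a one-node component it is i itself. -/
theorem singletonComponentsHaveLoops_of_isFeasible [Fintype A] {z : Vars A} (h : IsFeasible u z) :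
    SingletonComponentsHaveLoops u := by
  intro i hi
  obtain ⟨j, -, hj⟩ : ∃ j ∈ Finset.univ, 0 < z.pay i j := by
    refine (Finset.sum_pos_iff_of_nonneg fun j _ => h.pay_nonneg' i j).1 ?_
    rw [h.sum_out]
    exact h.price_pos i
  have harc := h.arc_of_pay_pos hj
  obtain ⟨k, hk⟩ := Set.ncard_eq_one.1 hi
  have hmi : i ∈ scc u i := ⟨.refl, .refl⟩
  have hmj : j ∈ scc u i := ⟨.single harc, reflTransGen_of_pay_pos h hj⟩
  have hji : j = i := by
    rw [hk] at hmi hmj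
    rw [Set.mem_singleton_iff.1 hmj, Set.mem_singleton_iff.1 hmi]
  exact ⟨i, hmi, hji ▸ harc⟩

/-- Under (⋆) every node has an outgoing arc that lies on a closed walk. -/
theorem exists_arc_on_closed_walk (h : SingletonComponentsHaveLoops u) (i : A) :
    ∃ j, Arc u i j ∧ Relation.ReflTransGen (Arc u) j i := by
  by_cases hi : (scc u i).ncard = 1
  · obtain ⟨k, hk, hkk⟩ := h i hi
    obtain ⟨l, hl⟩ := Set.ncard_eq_one.1 hi
    have hmi : i ∈ scc u i := ⟨.refl, .refl⟩
    rw [hl, Set.mem_singleton_iff] at hk hmi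
    subst hk
    subst hmi
    exact ⟨_, hkk, .refl⟩
  · have hmi : i ∈ scc u i := ⟨.refl, .refl⟩
    obtain ⟨k, hk, hki⟩ : ∃ k ∈ scc u i, k ≠ i := by
      by_contra! hn
      exact hi (Set.ncard_eq_one.2 ⟨i, Set.eq_singleton_iff_unique_mem.2 ⟨hmi, hn⟩⟩)
    rcases hk.1.cases_head with hik | ⟨j, hij, hjk⟩
    · exact absurd hik.symm hki
    · exact ⟨j, hij, hjk.trans hk.2⟩

end Feasible

variable [Fintype A]

/-! ### Construction of a feasible point -/

section Circulation

variable {u : A → A → ℝ}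

/-- A walk from `a` to `b` carries a unit flow from `a` to `b`. -/
theorem exists_unit_flow [DecidableEq A] {a b : A} (h : Relation.ReflTransGen (Arc u) a b) :
    ∃ f : A → A → ℝ, (∀ i j, 0 ≤ f i j) ∧ (∀ i j, ¬ Arc u i j → f i j = 0) ∧
      ∀ k, ∑ j, f k j - ∑ i, f i k = (if k = a then 1 else 0) - (if k = b then 1 else 0) := by
  induction h with
  | refl => exact ⟨fun _ _ => 0, fun _ _ => le_rfl, fun _ _ _ => rfl, fun k => by simp⟩
  | @tail b c _ hbc ih =>
    obtain ⟨f, hf0, hfa, hf⟩ := ih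
    refine ⟨fun i j => f i j + if i = b ∧ j = c then 1 else 0, fun i j => ?_, fun i j hij => ?_,
      fun k => ?_⟩
    · have := hf0 i j
      dsimp only
      split_ifs <;> linarith
    · dsimp only
      rw [hfa i j hij, if_neg, zero_add]
      rintro ⟨rfl, rfl⟩
      exact hij hbc
    · have h1 : ∑ j, (if k = b ∧ j = c then (1 : ℝ) else 0) = if k = b then 1 else 0 := by
        by_cases hk : k = b <;> simp [hk]
      have h2 : ∑ i, (if i = b ∧ k = c then (1 : ℝ) else 0) = if k = c then 1 else 0 := by
        by_cases hk : k = c <;> simp [hk]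
      simp only [Finset.sum_add_distrib, h1, h2]
      linarith [hf k]

/-- If every node has an outgoing arc on a closed walk, then there is a feasible point with
positive `β`. -/
theorem exists_isFeasible_pos (hu : ∀ i j, 0 ≤ u i j)
    (h : ∀ i, ∃ j, Arc u i j ∧ Relation.ReflTransGen (Arc u) j i) :
    ∃ z, IsFeasible u z ∧ ∀ i, 0 < z.invBpb i := by
  classical
  -- The arc ab closes a unit flow from b to a into a circulation with outflow at least 1 at a. The
  -- sum of these over all a has outflow at least 1 everywhere.
  have hcirc : ∀ a, ∃ f : A → A → ℝ, (∀ i j, 0 ≤ f i j) ∧ (∀ i j, ¬ Arc u i j → f i j = 0) ∧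
      (∀ k, ∑ i, f i k = ∑ j, f k j) ∧ 1 ≤ ∑ j, f a j := by
    intro a
    obtain ⟨b, hab, hba⟩ := h a
    obtain ⟨f, hf0, hfa, hf⟩ := exists_unit_flow hba
    have hg0 : ∀ i j, 0 ≤ f i j + if i = a ∧ j = b then 1 else 0 := fun i j => by
      have := hf0 i j
      split_ifs <;> linarith
    refine ⟨fun i j => f i j + if i = a ∧ j = b then 1 else 0, hg0, fun i j hij => ?_,
      fun k => ?_, ?_⟩
    · dsimp only
      rw [hfa i j hij, if_neg, zero_add]
      rintro ⟨rfl, rfl⟩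
      exact hij hab
    · have h1 : ∑ j, (if k = a ∧ j = b then (1 : ℝ) else 0) = if k = a then 1 else 0 := by
        by_cases hk : k = a <;> simp [hk]
      have h2 : ∑ i, (if i = a ∧ k = b then (1 : ℝ) else 0) = if k = b then 1 else 0 := by
        by_cases hk : k = b <;> simp [hk]
      simp only [Finset.sum_add_distrib, h1, h2]
      linarith [hf k]
    · have h1 := Finset.single_le_sum (f := fun j => f a j + if a = a ∧ j = b then 1 else 0)
        (fun j _ => hg0 a j) (Finset.mem_univ b)
      rw [if_pos ⟨rfl, rfl⟩] at h1
      linarith [hf0 a b]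
  choose f hf0 hfa hfc hf1 using hcirc
  -- The constant β = 1/U satisfies u_ij β ≤ 1 ≤ p_j; the summand 1 ensures U > 0.
  set U : ℝ := 1 + ∑ i, ∑ j, u i j with hU
  have hsum : 0 ≤ ∑ i, ∑ j, u i j := Finset.sum_nonneg fun i _ => Finset.sum_nonneg fun j _ => hu i j
  have hU0 : 0 < U := by linarith
  have huU : ∀ i j, u i j ≤ U := by
    intro i j
    have h1 := Finset.single_le_sum (f := fun j => u i j) (fun j _ => hu i j) (Finset.mem_univ j)
    have h2 := Finset.single_le_sum (f := fun i => ∑ j, u i j)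
      (fun i _ => Finset.sum_nonneg fun j _ => hu i j) (Finset.mem_univ i)
    linarith
  have hp : ∀ i, 1 ≤ ∑ j, ∑ a, f a i j := by
    intro i
    rw [Finset.sum_comm]
    exact (hf1 i).trans (Finset.single_le_sum (f := fun a => ∑ j, f a i j)
      (fun a _ => Finset.sum_nonneg fun j _ => hf0 a i j) (Finset.mem_univ i))
  refine ⟨(fun i j => ∑ a, f a i j, fun i => ∑ j, ∑ a, f a i j, fun _ => U⁻¹),
    isFeasible_of_sums (fun j => ?_) (fun i => rfl) (fun i j _ => ?_) hp
      (fun i j => Finset.sum_nonneg fun a _ => hf0 a i j) (fun _ => (inv_pos.2 hU0).le)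
      (fun i j hij => Finset.sum_eq_zero fun a _ => hfa a i j hij), fun _ => inv_pos.2 hU0⟩
  · change ∑ i, ∑ a, f a i j = ∑ k, ∑ a, f a j k
    rw [Finset.sum_comm, Finset.sum_comm (f := fun k a => f a j k)]
    exact Finset.sum_congr rfl fun a _ => hfc a j
  · refine le_trans ?_ (hp j)
    rw [← div_eq_mul_inv, div_le_one hU0]
    exact huU i j

end Circulation

/-! ### Optimality conditions and the minimum value -/

section Multipliers

variable {u : A → A → ℝ} {z : Vars A}

/-- The gradient of the objective. -/
noncomputable def objectiveGrad (u : A → A → ℝ) (z : Vars A) : Vars A →ₗ[ℝ] ℝ :=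
  ∑ i, ((Real.log (z.price i / z.invBpb i) + 1) • priceFun i
    - (z.price i / z.invBpb i) • invBpbFun i) - ∑ i, ∑ j, Real.log (u i j) • payFun i j

theorem objectiveGrad_apply (d : Vars A) : objectiveGrad u z d =
    ∑ i, ((Real.log (z.price i / z.invBpb i) + 1) * d.price i
      - (z.price i / z.invBpb i) * d.invBpb i) - ∑ i, ∑ j, Real.log (u i j) * d.pay i j := by
  simp [objectiveGrad, LinearMap.sum_apply]

theorem hasDerivAt_realObjective (hp : ∀ i, 0 < z.price i) (hβ : ∀ i, 0 < z.invBpb i)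
    (d : Vars A) :
    HasDerivAt (fun t : ℝ => realObjective u (z + t • d)) (objectiveGrad u z d) 0 := by
  rw [objectiveGrad_apply]
  have h1 : ∀ x y : ℝ, HasDerivAt (fun t : ℝ => x + t * y) y 0 := fun x y => by
    simpa using ((hasDerivAt_id (0 : ℝ)).mul_const y).const_add x
  refine HasDerivAt.sub (f := fun t : ℝ => ∑ i, (z.price i + t * d.price i) *
    Real.log ((z.price i + t * d.price i) / (z.invBpb i + t * d.invBpb i)))
    (g := fun t : ℝ => ∑ i, ∑ j, (z.pay i j + t * d.pay i j) * Real.log (u i j)) ?_ ?_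
  · refine HasDerivAt.fun_sum fun i _ => ?_
    have hp' := hp i
    have hb' := hβ i
    have h2 := (h1 (z.price i) (d.price i)).fun_div (h1 (z.invBpb i) (d.invBpb i))
      (by simpa using hb'.ne')
    have h3 := (h1 (z.price i) (d.price i)).fun_mul (h2.log (by
      rw [zero_mul, add_zero, zero_mul, add_zero]
      exact (div_pos hp' hb').ne'))
    refine h3.congr_deriv ?_
    simp only [zero_mul, add_zero]
    field_simp
    ring
  · refine HasDerivAt.fun_sum fun i _ => HasDerivAt.fun_sum fun j _ => ?_
    have := (h1 (z.pay i j) (d.pay i j)).mul_const (Real.log (u i j))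
    rwa [mul_comm (d.pay i j)] at this

/-- Euler's identity: the objective is homogeneous of degree one. -/
theorem objectiveGrad_self (hβ : ∀ i, 0 < z.invBpb i) :
    objectiveGrad u z z = realObjective u z := by
  rw [objectiveGrad_apply, realObjective]
  congr 1
  · refine Finset.sum_congr rfl fun i _ => ?_
    have := (hβ i).ne'
    field_simp
    ring
  · exact Finset.sum_congr rfl fun i _ => Finset.sum_congr rfl fun j _ => mul_comm _ _

/-- First order optimality at a minimizer. -/
theorem objectiveGrad_nonneg (hu : ∀ i j, 0 ≤ u i j) (h : IsFeasible u z)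
    (hβ : ∀ i, 0 < z.invBpb i)
    (hmin : ∀ w, IsFeasible u w → (∀ i, 0 < w.invBpb i) → realObjective u z ≤ realObjective u w)
    {d : Vars A} (hd : ∀ r, rowFun u r z = rowConst r → 0 ≤ rowFun u r d) :
    0 ≤ objectiveGrad u z d := by
  have h1 := (hasDerivAt_realObjective (u := u) h.price_pos hβ d).tendsto_slope_zero_right
  refine ge_of_tendsto h1 ?_
  have h2 := eventually_mem_polyhedron (rowFun u) (fun r => (rowConst r : ℝ))
    ((isFeasible_iff_forall_row hu).1 h) hd
  have h3 : ∀ᶠ t in nhdsWithin (0 : ℝ) (Set.Ioi 0), ∀ i, 0 < (z + t • d).invBpb i := by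
    rw [Filter.eventually_all]
    intro i
    have hc : Continuous fun t : ℝ => z.invBpb i + t * d.invBpb i := by fun_prop
    have := (hc.tendsto 0).eventually (lt_mem_nhds (by simpa using hβ i))
    exact this.filter_mono nhdsWithin_le_nhds
  filter_upwards [h2, h3, self_mem_nhdsWithin] with t ht2 ht3 ht
  have := hmin _ ((isFeasible_iff_forall_row hu).2 ht2) ht3
  have ht' : 0 < t := ht
  simp only [zero_add, zero_smul, add_zero, smul_eq_mul]
  exact mul_nonneg (inv_pos.2 ht').le (by linarith)

/-- Groups a conic combination of rows by constraint type; the two inequalities encoding a balance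
equation merge into one multiplier of arbitrary sign. -/
theorem sum_mul_rowFun (l : Row A → ℝ) (d : Vars A) :
    ∑ r, l r * rowFun u r d =
      ∑ j, (l (.inl (.inl j)) - l (.inl (.inr j))) * (∑ i, d.pay i j - d.price j)
      + ∑ i, (l (.inr (.inl (.inl i))) - l (.inr (.inl (.inr i)))) * (∑ j, d.pay i j - d.price i)
      + ∑ i, l (.inr (.inr (.inl (.inl i)))) * d.price i
      + ∑ i, l (.inr (.inr (.inl (.inr i)))) * d.invBpb i
      + ∑ i, ∑ j, l (.inr (.inr (.inr (.inl (i, j))))) * (d.price j - u i j * d.invBpb i)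
      + ∑ i, ∑ j, l (.inr (.inr (.inr (.inr (.inl (i, j)))))) * d.pay i j
      + ∑ i, ∑ j, l (.inr (.inr (.inr (.inr (.inr (i, j)))))) *
          ((if Arc u i j then 0 else -1) * d.pay i j) := by
  have e : ∀ (f g h : A → ℝ), ∑ i, (f i - g i) * h i = ∑ i, f i * h i + ∑ i, g i * -h i := by
    intro f g h
    rw [← Finset.sum_add_distrib]
    exact Finset.sum_congr rfl fun i _ => by ring
  simp only [Fintype.sum_sum_type, Fintype.sum_prod_type, rowFun, LinearMap.sub_apply,
    LinearMap.sum_apply, LinearMap.smul_apply, payFun_apply, priceFun_apply, invBpbFun_apply,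
    smul_eq_mul, e, neg_sub]
  ring

/-- The optimality conditions at a minimizer of the program. -/
theorem exists_multipliers (hu : ∀ i j, 0 ≤ u i j) (h : IsFeasible u z)
    (hβ : ∀ i, 0 < z.invBpb i)
    (hmin : ∀ w, IsFeasible u w → (∀ i, 0 < w.invBpb i) → realObjective u z ≤ realObjective u w) :
    ∃ (a b τ : A → ℝ) (w : A → A → ℝ), (∀ i, 0 ≤ τ i) ∧ (∀ i j, 0 ≤ w i j) ∧
      (∀ i j, Arc u i j → Real.log (u i j) + a j + b i ≤ 0) ∧
      (∀ q γ : A → ℝ, ∑ i, ((Real.log (z.price i / z.invBpb i) + 1) * q i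
          - (z.price i / z.invBpb i) * γ i) =
        -∑ i, (a i + b i) * q i + ∑ i, τ i * q i + ∑ i, ∑ j, w i j * (q j - u i j * γ i)) ∧
      realObjective u z = ∑ i, τ i := by
  classical
  obtain ⟨l₀, hl₀, hcl₀⟩ := farkas_finset
    (Finset.univ.filter fun r => rowFun u r z = rowConst r) (rowFun u) (objectiveGrad u z)
    (fun d hd => objectiveGrad_nonneg hu h hβ hmin fun r hr => hd r (by simpa using hr))
  -- Extending by zero to the slack rows builds in complementary slackness, which is `hlt`.
  set l : Row A → ℝ := fun r => if rowFun u r z = rowConst r then l₀ r else 0 with hl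
  have hl0 : ∀ r, 0 ≤ l r := fun r => by
    rw [hl]
    dsimp only
    split_ifs
    exacts [hl₀ r, le_rfl]
  have hlt : ∀ r, l r * rowFun u r z = l r * rowConst r := fun r => by
    by_cases hr : rowFun u r z = rowConst r
    · rw [hr]
    · simp [hl, hr]
  have hcl : ∀ d, objectiveGrad u z d = ∑ r, l r * rowFun u r d := by
    intro d
    rw [hcl₀ d, Finset.sum_filter]
    exact Finset.sum_congr rfl fun r _ => by simp [hl, ite_mul]
  have hσ : ∀ i, l (.inr (.inr (.inl (.inr i)))) = 0 := by
    intro i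
    have := hlt (.inr (.inr (.inl (.inr i))))
    simp only [rowFun, rowConst, invBpbFun_apply, Int.cast_zero, mul_zero] at this
    exact (mul_eq_zero.1 this).resolve_right (hβ i).ne'
  refine ⟨fun j => l (.inl (.inl j)) - l (.inl (.inr j)),
    fun i => l (.inr (.inl (.inl i))) - l (.inr (.inl (.inr i))),
    fun i => l (.inr (.inr (.inl (.inl i)))), fun i j => l (.inr (.inr (.inr (.inl (i, j))))),
    fun i => hl0 _, fun i j => hl0 _, fun i j hij => ?_, fun q γ => ?_, ?_⟩
  -- Stationarity along a unit payment on the arc ij; dropping the nonnegative multiplier of y_ij ≥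
  -- 0 leaves the inequality.
  · have h1 := hcl (fun k m => if k = i ∧ m = j then 1 else 0, 0, 0)
    rw [sum_mul_rowFun, objectiveGrad_apply] at h1
    have e1 : ∀ m, ∑ k, (if k = i ∧ m = j then (1 : ℝ) else 0) = if m = j then 1 else 0 := by
      intro m
      by_cases hm : m = j <;> simp [hm]
    have e2 : ∀ k, ∑ m, (if k = i ∧ m = j then (1 : ℝ) else 0) = if k = i then 1 else 0 := by
      intro k
      by_cases hk : k = i <;> simp [hk]
    have e3 : ∀ F : A → A → ℝ,
        ∑ k, ∑ m, F k m * (if k = i ∧ m = j then (1 : ℝ) else 0) = F i j := by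
      intro F
      rw [Finset.sum_eq_single i, Finset.sum_eq_single j]
      · simp
      · intro m _ hm
        simp [hm]
      · simp
      · intro k _ hk
        simp [hk]
      · simp
    simp only [Vars.pay, Vars.price, Vars.invBpb, Pi.zero_apply, mul_zero, sub_zero,
      Finset.sum_const_zero, zero_sub, add_zero, e1, e2, e3, ← mul_assoc, if_pos hij] at h1
    simp only [mul_ite, mul_one, mul_zero, Finset.sum_ite_eq', Finset.mem_univ, if_true] at h1
    have h2 := hl0 (.inr (.inr (.inr (.inr (.inl (i, j))))))
    linarith
  · have h1 := hcl (0, q, γ)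
    rw [sum_mul_rowFun, objectiveGrad_apply] at h1
    simp only [Vars.pay, Vars.price, Vars.invBpb, Pi.zero_apply, mul_zero, sub_zero,
      Finset.sum_const_zero, zero_sub, add_zero, hσ, zero_mul] at h1
    rw [h1, ← Finset.sum_neg_distrib]
    congr 2
    rw [← Finset.sum_add_distrib]
    exact Finset.sum_congr rfl fun i _ => by ring
  -- By Euler's identity the value is the gradient applied to z itself. Complementary slackness
  -- replaces each row by its right-hand side, nonzero only for p_i ≥ 1.
  · rw [← objectiveGrad_self hβ, hcl, Finset.sum_congr rfl fun r _ => hlt r]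
    simp [Fintype.sum_sum_type, rowConst]

/-- The minimum of the program, if attained, is zero. -/
theorem realObjective_eq_zero_of_minimal (hu : ∀ i j, 0 ≤ u i j) (h : IsFeasible u z)
    (hβ : ∀ i, 0 < z.invBpb i)
    (hmin : ∀ w, IsFeasible u w → (∀ i, 0 < w.invBpb i) → realObjective u z ≤ realObjective u w) :
    realObjective u z = 0 := by
  obtain ⟨a, b, τ, w, hτ, hw, hY, hD, hobj⟩ := exists_multipliers hu h hβ hmin
  -- The dual solution read as a primal one: the condition on the arcs is u_ij e^{b_i} ≤ e^{-a_j},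
  -- so the w-term is nonnegative in this direction.
  have h1 := hD (fun i => Real.exp (-a i)) (fun i => Real.exp (b i))
  have h2 : 0 ≤ ∑ i, ∑ j, w i j * (Real.exp (-a j) - u i j * Real.exp (b i)) := by
    refine Finset.sum_nonneg fun i _ => Finset.sum_nonneg fun j _ => mul_nonneg (hw i j) ?_
    by_cases hij : Arc u i j
    · have h3 : Real.exp (Real.log (u i j)) * Real.exp (b i) ≤ Real.exp (-a j) := by
        rw [← Real.exp_add]
        exact Real.exp_le_exp.2 (by linarith [hY i j hij])
      rw [Real.exp_log hij] at h3
      linarith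
    · rw [le_antisymm (not_lt.1 hij) (hu i j)]
      simpa using (Real.exp_pos _).le
  have h3 : ∑ i, ((Real.log (z.price i / z.invBpb i) + 1) * Real.exp (-a i)
      - (z.price i / z.invBpb i) * Real.exp (b i)) ≤ -∑ i, (a i + b i) * Real.exp (-a i) := by
    rw [← Finset.sum_neg_distrib]
    refine Finset.sum_le_sum fun i _ => ?_
    have hr : 0 < z.price i / z.invBpb i := div_pos (h.price_pos i) (hβ i)
    -- With r = p_i/β_i this reads log r + a_i + b_i ≤ r e^{a_i + b_i} - 1; multiplication by
    -- e^{-a_i} gives the i-th summand of the claim.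
    have h4 := Real.log_le_sub_one_of_pos (mul_pos hr (Real.exp_pos (a i + b i)))
    rw [Real.log_mul hr.ne' (Real.exp_pos _).ne', Real.log_exp] at h4
    have h5 := mul_le_mul_of_nonneg_right h4 (Real.exp_pos (-a i)).le
    have h6 : Real.exp (a i + b i) * Real.exp (-a i) = Real.exp (b i) := by
      rw [← Real.exp_add]
      congr 1
      ring
    have h7 : (z.price i / z.invBpb i * Real.exp (a i + b i) - 1) * Real.exp (-a i)
        = z.price i / z.invBpb i * Real.exp (b i) - Real.exp (-a i) := by
      rw [← h6]
      ring
    rw [h7] at h5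
    linarith
  have h8 : ∀ i ∈ Finset.univ, 0 ≤ τ i * Real.exp (-a i) := fun i _ =>
    mul_nonneg (hτ i) (Real.exp_pos _).le
  have h9 : ∑ i, τ i * Real.exp (-a i) = 0 :=
    le_antisymm (by linarith) (Finset.sum_nonneg h8)
  rw [hobj]
  refine Finset.sum_eq_zero fun i hi => ?_
  exact (mul_eq_zero.1 ((Finset.sum_eq_zero_iff_of_nonneg h8).1 h9 i hi)).resolve_right
    (Real.exp_pos _).ne'

end Multipliers

/-! ### A priori bounds and existence of a minimizer -/

section Attainment

variable {u : A → A → ℝ}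

/-- In a feasible point of bounded objective, the good on which agent `i` spends most is nearly of
best bang-per-buck. -/
theorem exists_good_near_best {z : Vars A} (h : IsFeasible u z)
    (hβ : ∀ i, 0 < z.invBpb i) {f₀ : ℝ} (hf : realObjective u z ≤ f₀) (i : A) :
    ∃ m, z.price i ≤ Fintype.card A * z.price m ∧ Arc u i m ∧
      z.price m ≤ Real.exp (Fintype.card A * f₀) * (u i m * z.invBpb i) := by
  have hn : (0 : ℝ) < Fintype.card A := by
    exact_mod_cast Fintype.card_pos_iff.2 ⟨i⟩
  -- Averaging: some good receives at least p_i/n ≥ 1/n of the money of i, where n is the number of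
  -- agents, so its logarithmic gap is at most n f₀.
  obtain ⟨m, -, hm⟩ : ∃ m ∈ Finset.univ, z.price i / Fintype.card A ≤ z.pay i m := by
    by_contra! hlt
    have := Finset.sum_lt_sum_of_nonempty ⟨i, Finset.mem_univ i⟩ hlt
    rw [h.sum_out, Finset.sum_const, Finset.card_univ, nsmul_eq_mul,
      mul_div_cancel₀ _ hn.ne'] at this
    exact lt_irrefl _ this
  have hpm : z.pay i m ≤ z.price m := by
    rw [← h.sum_in m]
    exact Finset.single_le_sum (f := fun k => z.pay k m) (fun k _ => h.pay_nonneg' k m)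
      (Finset.mem_univ i)
  have hy1 : 1 / (Fintype.card A : ℝ) ≤ z.pay i m :=
    le_trans (div_le_div_of_nonneg_right (h.one_le_price i) hn.le) hm
  have hy : 0 < z.pay i m := lt_of_lt_of_le (by positivity) hy1
  have harc := h.arc_of_pay_pos hy
  refine ⟨m, ?_, harc, ?_⟩
  · rw [div_le_iff₀ hn] at hm
    nlinarith
  · have h1 := (pay_mul_gap_le h hβ i m).trans hf
    have hg := gap_nonneg h hβ harc
    have h2 := mul_le_mul_of_nonneg_right hy1 hg
    have h3 : Real.log (z.price m) - Real.log (z.invBpb i) - Real.log (u i m)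
        ≤ Fintype.card A * f₀ := by
      have h4 := h2.trans h1
      rw [one_div, ← div_eq_inv_mul, div_le_iff₀ hn] at h4
      linarith
    have hub : 0 < u i m * z.invBpb i := mul_pos harc (hβ i)
    rw [← Real.log_le_log_iff (h.price_pos m) (by positivity),
      Real.log_mul (Real.exp_pos _).ne' hub.ne', Real.log_exp, Real.log_mul (ne_of_gt harc) (hβ i).ne']
    linarith

theorem exists_bound (u : A → A → ℝ) : ∃ U : ℝ, 0 < U ∧ ∀ i j, u i j ≤ U := by
  obtain ⟨U, hU⟩ := (Set.finite_range fun ij : A × A => u ij.1 ij.2).bddAbove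
  exact ⟨max U 1, by positivity, fun i j => le_max_of_le_left (hU ⟨(i, j), rfl⟩)⟩

/-- Lower bound on `β` in feasible points of bounded objective. -/
theorem exists_invBpb_lower_bound (u : A → A → ℝ) (f₀ : ℝ) :
    ∃ δ > 0, ∀ z, IsFeasible u z → (∀ i, 0 < z.invBpb i) → realObjective u z ≤ f₀ →
      ∀ i, δ ≤ z.invBpb i := by
  obtain ⟨U, hU, huU⟩ := exists_bound u
  refine ⟨(Real.exp (Fintype.card A * f₀) * U)⁻¹, by positivity, fun z h hβ hf i => ?_⟩
  obtain ⟨m, -, -, hm⟩ := exists_good_near_best h hβ hf i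
  rw [inv_le_iff_one_le_mul₀ (by positivity)]
  refine (h.one_le_price m).trans (hm.trans ?_)
  have := mul_le_mul_of_nonneg_left (mul_le_mul_of_nonneg_right (huU i m) (hβ i).le)
    (Real.exp_pos (Fintype.card A * f₀)).le
  linarith

/-- In feasible points of bounded objective, prices do not drop by much along a walk. -/
theorem exists_price_bound_of_reflTransGen (f₀ : ℝ) {i j : A}
    (hij : Relation.ReflTransGen (Arc u) i j) :
    ∃ C > 0, ∀ z, IsFeasible u z → (∀ i, 0 < z.invBpb i) → realObjective u z ≤ f₀ →
      z.price i ≤ C * z.price j := by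
  induction hij with
  | refl => exact ⟨1, one_pos, fun z _ _ _ => by simp⟩
  | @tail k j _ hkj ih =>
    obtain ⟨C, hC, hCz⟩ := ih
    obtain ⟨U, hU, huU⟩ := exists_bound u
    have hn : (0 : ℝ) < Fintype.card A := by
      exact_mod_cast Fintype.card_pos_iff.2 ⟨i⟩
    have hkj' : 0 < u k j := hkj
    refine ⟨C * (Fintype.card A * (Real.exp (Fintype.card A * f₀) * (U / u k j))), by positivity,
      fun z h hβ hf => ?_⟩
    obtain ⟨m, hm1, harc, hm2⟩ := exists_good_near_best h hβ hf k
    have h1 : z.invBpb k ≤ z.price j / u k j := by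
      rw [le_div_iff₀ hkj', mul_comm]
      exact h.bpb k j hkj
    -- The arc kj bounds β_k by p_j / u_kj, while p_k ≤ n p_m and p_m is at most a constant times
    -- u_km β_k. Chaining these bounds p_k by a multiple of p_j.
    have h2 : u k m * z.invBpb k ≤ U * (z.price j / u k j) :=
      mul_le_mul (huU k m) h1 (hβ k).le hU.le
    have h3 : z.price k
        ≤ Fintype.card A * (Real.exp (Fintype.card A * f₀) * (U * (z.price j / u k j))) :=
      hm1.trans (mul_le_mul_of_nonneg_left
        (hm2.trans (mul_le_mul_of_nonneg_left h2 (Real.exp_pos _).le)) hn.le)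
    calc z.price i ≤ C * z.price k := hCz z h hβ hf
      _ ≤ C * (Fintype.card A * (Real.exp (Fintype.card A * f₀) * (U * (z.price j / u k j)))) :=
        mul_le_mul_of_nonneg_left h3 hC.le
      _ = _ := by ring

/-- Scaling the variables of every agent by a factor that is constant along arcs. -/
def scale {A : Type*} (μ : A → ℝ) (z : Vars A) : Vars A :=
  (fun i j => μ i * z.pay i j, fun i => μ i * z.price i, fun i => μ i * z.invBpb i)

theorem scale_pay {A : Type*} (μ : A → ℝ) (z : Vars A) (i j : A) :
    (scale μ z).pay i j = μ i * z.pay i j := rfl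

theorem scale_price {A : Type*} (μ : A → ℝ) (z : Vars A) (i : A) :
    (scale μ z).price i = μ i * z.price i := rfl

theorem scale_invBpb {A : Type*} (μ : A → ℝ) (z : Vars A) (i : A) :
    (scale μ z).invBpb i = μ i * z.invBpb i := rfl

/-- In a market all of whose arcs lie on closed walks, every feasible point can be scaled, without
increasing the objective, such that from every node a node of price one can be reached. -/
theorem exists_normalized (hsymm : ∀ i j, Arc u i j → Relation.ReflTransGen (Arc u) j i)
    {z : Vars A} (h : IsFeasible u z) (hβ : ∀ i, 0 < z.invBpb i) :
    ∃ z', IsFeasible u z' ∧ (∀ i, 0 < z'.invBpb i) ∧ realObjective u z' ≤ realObjective u z ∧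
      ∀ i, ∃ k, Relation.ReflTransGen (Arc u) i k ∧ z'.price k = 1 := by
  -- The scaling factor is the inverse of the minimum price reachable from i. It agrees at both ends
  -- of an arc, since each end is reachable from the other.
  have hex : ∀ i, ∃ k, Relation.ReflTransGen (Arc u) i k ∧
      ∀ l, Relation.ReflTransGen (Arc u) i l → z.price k ≤ z.price l := by
    intro i
    have : Nonempty {k // Relation.ReflTransGen (Arc u) i k} := ⟨⟨i, .refl⟩⟩
    obtain ⟨⟨k, hk⟩, hmin⟩ := Finite.exists_min
      (fun k : {k // Relation.ReflTransGen (Arc u) i k} => z.price k)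
    exact ⟨k, hk, fun l hl => hmin ⟨l, hl⟩⟩
  choose κ hκ hκmin using hex
  have hκarc : ∀ i j, Arc u i j → z.price (κ i) = z.price (κ j) := fun i j hij =>
    le_antisymm (hκmin i _ ((hκ j).head hij)) (hκmin j _ ((hsymm i j hij).trans (hκ i)))
  have hκwalk : ∀ i k, Relation.ReflTransGen (Arc u) i k → z.price (κ i) = z.price (κ k) := by
    intro i k hik
    induction hik with
    | refl => rfl
    | tail _ hjk ih => exact ih.trans (hκarc _ _ hjk)
  set μ : A → ℝ := fun i => (z.price (κ i))⁻¹ with hμ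
  have hμ0 : ∀ i, 0 < μ i := fun i => inv_pos.2 (h.price_pos _)
  have hμ1 : ∀ i, μ i ≤ 1 := fun i => inv_le_one_of_one_le₀ (h.one_le_price _)
  have hμarc : ∀ i j, Arc u i j → μ i = μ j := fun i j hij => by
    simp only [hμ, hκarc i j hij]
  have hμpay : ∀ i j, μ i * z.pay i j = μ j * z.pay i j := fun i j => by
    by_cases hij : Arc u i j
    · rw [hμarc i j hij]
    · rw [h.pay_arc i j hij, mul_zero, mul_zero]
  have hfeas : IsFeasible u (scale μ z) := by
    refine isFeasible_of_sums (fun j => ?_) (fun i => ?_) (fun i j hij => ?_) (fun i => ?_)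
      (fun i j => mul_nonneg (hμ0 i).le (h.pay_nonneg' i j))
      (fun i => (mul_pos (hμ0 i) (hβ i)).le)
      (fun i j hij => by simp only [scale_pay, h.pay_arc i j hij, mul_zero])
    · simp only [scale_pay, scale_price, hμpay _ j, ← Finset.mul_sum, h.sum_in]
    · simp only [scale_pay, scale_price, ← Finset.mul_sum, h.sum_out]
    · have := mul_le_mul_of_nonneg_left (h.bpb i j hij) (hμ0 i).le
      simp only [scale_price, scale_invBpb, ← hμarc i j hij]
      linarith
    · simp only [scale_price, hμ]
      rw [← div_eq_inv_mul, one_le_div (h.price_pos _)]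
      exact hκmin i i .refl
  have hβ' : ∀ i, 0 < (scale μ z).invBpb i := fun i => mul_pos (hμ0 i) (hβ i)
  refine ⟨scale μ z, hfeas, hβ', ?_, fun i => ⟨κ i, hκ i, ?_⟩⟩
  -- The logarithmic gaps are unchanged and the payments shrink by factors at most 1, so no term
  -- grows.
  · rw [realObjective_eq_sum hfeas hβ', realObjective_eq_sum h hβ]
    refine Finset.sum_le_sum fun i _ => Finset.sum_le_sum fun j _ => ?_
    have h0 := pay_mul_gap_nonneg h hβ i j
    by_cases hij : Arc u i j
    · have e : Real.log (μ j * z.price j) - Real.log (μ i * z.invBpb i)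
          = Real.log (z.price j) - Real.log (z.invBpb i) := by
        rw [Real.log_mul (hμ0 j).ne' (h.price_pos j).ne', Real.log_mul (hμ0 i).ne' (hβ i).ne',
          hμarc i j hij]
        ring
      simp only [scale_pay, scale_price, scale_invBpb]
      rw [e, mul_assoc]
      exact mul_le_of_le_one_left h0 (hμ1 i)
    · simp [scale_pay, h.pay_arc i j hij]
  · simp only [scale_price, hμ]
    rw [← hκwalk i (κ i) (hκ i), inv_mul_cancel₀ (h.price_pos _).ne']

/-- In a market all of whose arcs lie on closed walks and in which every node has an outgoing arc,
the program attains the value zero. -/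
theorem exists_realObjective_eq_zero_of_closed (hu : ∀ i j, 0 ≤ u i j)
    (hsymm : ∀ i j, Arc u i j → Relation.ReflTransGen (Arc u) j i) (hout : ∀ i, ∃ j, Arc u i j) :
    ∃ z, IsFeasible u z ∧ (∀ i, 0 < z.invBpb i) ∧ realObjective u z = 0 := by
  classical
  obtain ⟨z₀, hz₀, hβ₀⟩ := exists_isFeasible_pos hu fun i =>
    (hout i).imp fun j hij => ⟨hij, hsymm i j hij⟩
  set f₀ := realObjective u z₀ with hf₀
  obtain ⟨δ, hδ, hδz⟩ := exists_invBpb_lower_bound u f₀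
  obtain ⟨N, hN⟩ : ∃ N : ℝ, ∀ z, IsFeasible u z → (∀ i, 0 < z.invBpb i) →
      realObjective u z ≤ f₀ → (∀ i, ∃ k, Relation.ReflTransGen (Arc u) i k ∧ z.price k = 1) →
      ∀ i, z.price i ≤ N := by
    have hC : ∀ i k, ∃ C : ℝ, 0 ≤ C ∧ (Relation.ReflTransGen (Arc u) i k →
        ∀ z, IsFeasible u z → (∀ i, 0 < z.invBpb i) → realObjective u z ≤ f₀ →
          z.price i ≤ C * z.price k) := by
      intro i k
      by_cases hik : Relation.ReflTransGen (Arc u) i k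
      · obtain ⟨C, hC, h⟩ := exists_price_bound_of_reflTransGen f₀ hik
        exact ⟨C, hC.le, fun _ => h⟩
      · exact ⟨0, le_rfl, fun h => absurd h hik⟩
    choose C hC0 hC using hC
    obtain ⟨N, -, hN⟩ := exists_bound C
    refine ⟨N, fun z h hβ hf hk i => ?_⟩
    obtain ⟨k, hik, hk1⟩ := hk i
    have := hC i k hik z h hβ hf
    rw [hk1, mul_one] at this
    exact this.trans (hN i k)
  choose τ hτ using hout
  -- Every point of value at most f₀ can be normalized into K. The lower bound δ on β keeps K away
  -- from the singularity of the objective, so a minimizer over K exists and is global.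
  set K : Set (Vars A) := {z | IsFeasible u z ∧ (∀ i, z.price i ≤ N) ∧ ∀ i, δ ≤ z.invBpb i} with hK
  have hKcompact : IsCompact K := by
    have hsub : K ⊆ Set.Icc ((fun _ _ => 0, fun _ => 0, fun _ => 0) : Vars A)
        (fun _ _ => N, fun _ => N, fun i => N / u i (τ i)) := by
      rintro z ⟨h, hzN, -⟩
      refine ⟨⟨fun i j => h.pay_nonneg' i j, fun i => (h.price_pos i).le, h.invBpb_nonneg⟩,
        ⟨fun i j => ?_, hzN, fun i => ?_⟩⟩
      · refine le_trans ?_ (hzN i)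
        rw [← h.sum_out i]
        exact Finset.single_le_sum (f := fun j => z.pay i j) (fun j _ => h.pay_nonneg' i j)
          (Finset.mem_univ j)
      · have hpos : 0 < u i (τ i) := hτ i
        change z.invBpb i ≤ N / u i (τ i)
        rw [le_div_iff₀ hpos, mul_comm]
        exact (h.bpb i _ (hτ i)).trans (hzN _)
    refine isCompact_Icc.of_isClosed_subset ?_ hsub
    have hclosed : IsClosed {z : Vars A | IsFeasible u z} := by
      simp only [isFeasible_iff_forall_row hu, Set.ofPred_forall]
      exact isClosed_iInter fun r => isClosed_le continuous_const
        (LinearMap.continuous_of_finiteDimensional _)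
    have hclosed₁ : IsClosed {z : Vars A | ∀ i, z.price i ≤ N} := by
      simp only [Set.ofPred_forall]
      exact isClosed_iInter fun i => isClosed_le
        (LinearMap.continuous_of_finiteDimensional (priceFun i)) continuous_const
    have hclosed₂ : IsClosed {z : Vars A | ∀ i, δ ≤ z.invBpb i} := by
      simp only [Set.ofPred_forall]
      exact isClosed_iInter fun i => isClosed_le continuous_const
        (LinearMap.continuous_of_finiteDimensional (invBpbFun i))
    exact hclosed.inter (hclosed₁.inter hclosed₂)
  have hnorm : ∀ z, IsFeasible u z → (∀ i, 0 < z.invBpb i) → realObjective u z ≤ f₀ →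
      ∃ z' ∈ K, realObjective u z' ≤ realObjective u z := by
    intro z h hβ hf
    obtain ⟨z', h', hβ', hle, hk⟩ := exists_normalized hsymm h hβ
    exact ⟨z', ⟨h', hN z' h' hβ' (hle.trans hf) hk, hδz z' h' hβ' (hle.trans hf)⟩, hle⟩
  have hKne : K.Nonempty := by
    obtain ⟨z', hz', -⟩ := hnorm z₀ hz₀ hβ₀ le_rfl
    exact ⟨z', hz'⟩
  have hcont : ContinuousOn (realObjective u) K := by
    have hc1 : ∀ i, Continuous fun z : Vars A => z.price i := fun i =>
      LinearMap.continuous_of_finiteDimensional (priceFun i)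
    have hc2 : ∀ i, Continuous fun z : Vars A => z.invBpb i := fun i =>
      LinearMap.continuous_of_finiteDimensional (invBpbFun i)
    have hc3 : ∀ i j, Continuous fun z : Vars A => z.pay i j := fun i j =>
      LinearMap.continuous_of_finiteDimensional (payFun i j)
    refine ContinuousOn.sub (continuousOn_finsetSum _ fun i _ => ?_)
      (continuousOn_finsetSum _ fun i _ => continuousOn_finsetSum _ fun j _ =>
        (hc3 i j).continuousOn.mul continuousOn_const)
    refine (hc1 i).continuousOn.mul (ContinuousOn.log ((hc1 i).continuousOn.div
      (hc2 i).continuousOn fun z hz => (hδ.trans_le (hz.2.2 i)).ne') fun z hz => ?_)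
    exact (div_pos (hz.1.price_pos i) (hδ.trans_le (hz.2.2 i))).ne'
  obtain ⟨z, hzK, hzmin⟩ := hKcompact.exists_isMinOn hKne hcont
  have hzβ : ∀ i, 0 < z.invBpb i := fun i => hδ.trans_le (hzK.2.2 i)
  refine ⟨z, hzK.1, hzβ, realObjective_eq_zero_of_minimal hu hzK.1 hzβ fun w hw hβw => ?_⟩
  rcases le_total (realObjective u w) f₀ with hle | hle
  · obtain ⟨w', hw', hww⟩ := hnorm w hw hβw hle
    exact (hzmin hw').trans hww
  · obtain ⟨w', hw', hww⟩ := hnorm z₀ hz₀ hβ₀ le_rfl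
    exact ((hzmin hw').trans hww).trans hle

end Attainment

/-! ### Gluing the strongly connected components -/

section Gluing

variable {u : A → A → ℝ}

/-- The market in which only the arcs on closed walks are kept. -/
noncomputable def closedPart {A : Type*} (u : A → A → ℝ) (i j : A) : ℝ :=
  open Classical in if Relation.ReflTransGen (Arc u) j i then u i j else 0

theorem arc_closedPart_iff {A : Type*} {u : A → A → ℝ} {i j : A} :
    Arc (closedPart u) i j ↔ Arc u i j ∧ Relation.ReflTransGen (Arc u) j i := by
  unfold Arc closedPart
  split_ifs with h
  · exact ⟨fun hh => ⟨hh, h⟩, fun hh => hh.1⟩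
  · exact ⟨fun hh => absurd hh (lt_irrefl _), fun hh => absurd hh.2 h⟩

theorem reflTransGen_closedPart {A : Type*} {u : A → A → ℝ} {a b : A}
    (hab : Relation.ReflTransGen (Arc u) a b) (hba : Relation.ReflTransGen (Arc u) b a) :
    Relation.ReflTransGen (Arc (closedPart u)) a b := by
  induction hab using Relation.ReflTransGen.head_induction_on with
  | refl => exact .refl
  | head hac hcb ih =>
    exact (ih (hba.tail hac)).head (arc_closedPart_iff.2 ⟨hac, hcb.trans hba⟩)

/-- Under (⋆) the program attains the value zero. -/
theorem exists_objective_nonpos (hu : ∀ i j, 0 ≤ u i j) (h : SingletonComponentsHaveLoops u) :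
    ∃ z, IsFeasible u z ∧ objective u z ≤ 0 := by
  classical
  have hu' : ∀ i j, 0 ≤ closedPart u i j := fun i j => by
    unfold closedPart
    split_ifs
    exacts [hu i j, le_rfl]
  obtain ⟨z, hz, hβ, h0⟩ := exists_realObjective_eq_zero_of_closed hu'
    (fun i j hij => reflTransGen_closedPart (arc_closedPart_iff.1 hij).2
      (.single (arc_closedPart_iff.1 hij).1))
    (fun i => (exists_arc_on_closed_walk h i).imp fun j hij => arc_closedPart_iff.2 hij)
  rw [realObjective_eq_zero_iff hz hβ] at h0
  obtain ⟨L₀, -, hL₀⟩ := exists_bound fun i j => u i j * z.invBpb i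
  set L : ℝ := max L₀ 1 with hL
  have hL1 : 1 ≤ L := le_max_right _ _
  have hLb : ∀ i j, u i j * z.invBpb i ≤ L := fun i j => (hL₀ i j).trans (le_max_left _ _)
  -- The number of ancestors is constant on components and grows along every arc between components.
  -- The price factor L ^ (number of ancestors) therefore gains at least L there, enough since u_ij
  -- β_i ≤ L and p_j ≥ 1.
  set anc : A → Finset A := fun i =>
    Finset.univ.filter fun k => Relation.ReflTransGen (Arc u) k i with hanc
  have hsub : ∀ i j, Arc u i j → anc i ⊆ anc j := fun i j hij k hk => by
    simp only [hanc, Finset.mem_filter, Finset.mem_univ, true_and] at hk ⊢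
    exact hk.tail hij
  have hssub : ∀ i j, Arc u i j → ¬ Relation.ReflTransGen (Arc u) j i →
      (anc i).card + 1 ≤ (anc j).card := fun i j hij hn => by
    refine Finset.card_lt_card ((Finset.ssubset_iff_of_subset (hsub i j hij)).2 ⟨j, ?_, ?_⟩)
    · simp only [hanc, Finset.mem_filter, Finset.mem_univ, true_and]
      exact .refl
    · simpa [hanc] using hn
  have heq : ∀ i j, Arc (closedPart u) i j → (anc i).card = (anc j).card := fun i j hij => by
    obtain ⟨h1, h2⟩ := arc_closedPart_iff.1 hij
    refine congrArg _ (Finset.Subset.antisymm (hsub i j h1) fun k hk => ?_)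
    simp only [hanc, Finset.mem_filter, Finset.mem_univ, true_and] at hk ⊢
    exact hk.trans h2
  set μ : A → ℝ := fun i => L ^ (anc i).card with hμ
  have hμ1 : ∀ i, 1 ≤ μ i := fun i => one_le_pow₀ hL1
  have hμ0 : ∀ i, 0 < μ i := fun i => one_pos.trans_le (hμ1 i)
  have hμarc : ∀ i j, Arc (closedPart u) i j → μ i = μ j := fun i j hij => by
    simp only [hμ, heq i j hij]
  have hμpay : ∀ i j, μ i * z.pay i j = μ j * z.pay i j := fun i j => by
    by_cases hij : Arc (closedPart u) i j
    · rw [hμarc i j hij]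
    · rw [hz.pay_arc i j hij, mul_zero, mul_zero]
  have hval : ∀ i j, Arc (closedPart u) i j → closedPart u i j = u i j := fun i j hij =>
    if_pos (arc_closedPart_iff.1 hij).2
  have hfeas : IsFeasible u (scale μ z) := by
    refine isFeasible_of_sums (fun j => ?_) (fun i => ?_) (fun i j hij => ?_) (fun i => ?_)
      (fun i j => mul_nonneg (hμ0 i).le (hz.pay_nonneg' i j))
      (fun i => (mul_pos (hμ0 i) (hβ i)).le) (fun i j hij => ?_)
    · simp only [scale_pay, scale_price, hμpay _ j, ← Finset.mul_sum, hz.sum_in]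
    · simp only [scale_pay, scale_price, ← Finset.mul_sum, hz.sum_out]
    · simp only [scale_price, scale_invBpb]
      by_cases hji : Relation.ReflTransGen (Arc u) j i
      · have hij' := arc_closedPart_iff.2 ⟨hij, hji⟩
        have h1 := hz.bpb i j hij'
        rw [hval i j hij'] at h1
        have := mul_le_mul_of_nonneg_left h1 (hμ0 i).le
        rw [← hμarc i j hij']
        linarith
      · have h1 : μ i * L ≤ μ j := by
          simp only [hμ]
          rw [← pow_succ]
          exact pow_le_pow_right₀ hL1 (hssub i j hij hji)
        calc u i j * (μ i * z.invBpb i) = μ i * (u i j * z.invBpb i) := by ring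
          _ ≤ μ i * L := mul_le_mul_of_nonneg_left (hLb i j) (hμ0 i).le
          _ ≤ μ j := h1
          _ ≤ μ j * z.price j := le_mul_of_one_le_right (hμ0 j).le (hz.one_le_price j)
    · exact one_le_mul_of_one_le_of_one_le (hμ1 i) (hz.one_le_price i)
    · have : z.pay i j = 0 := hz.pay_arc i j fun hc => hij (arc_closedPart_iff.1 hc).1
      simp only [scale_pay, this, mul_zero]
  refine ⟨scale μ z, hfeas, (objective_nonpos_iff hfeas).2
    ⟨fun i => mul_pos (hμ0 i) (hβ i), fun i j hij => ?_⟩⟩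
  have hij0 : z.pay i j ≠ 0 := fun hn => hij (by simp only [scale_pay, hn, mul_zero])
  have harc := hz.arc_of_pay_pos (lt_of_le_of_ne (hz.pay_nonneg' i j) hij0.symm)
  have h1 := h0 i j hij0
  rw [hval i j harc] at h1
  simp only [scale_price, scale_invBpb]
  rw [← hμarc i j harc, ← h1]
  ring

/-- The value 0 is attained and is a lower bound, so optimality becomes a condition on the point
alone. -/
theorem isOptimal_iff (hu : ∀ i j, 0 ≤ u i j) (h : SingletonComponentsHaveLoops u) {z : Vars A} :
    IsOptimal u z ↔ IsFeasible u z ∧ objective u z ≤ 0 := by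
  constructor
  · rintro ⟨hz, hmin⟩
    obtain ⟨w, hw, hw0⟩ := exists_objective_nonpos hu h
    exact ⟨hz, (hmin w hw).trans hw0⟩
  · rintro ⟨hz, hz0⟩
    exact ⟨hz, fun w hw => hz0.trans (objective_nonneg hw)⟩

theorem isLeast_objective (hu : ∀ i j, 0 ≤ u i j) (h : SingletonComponentsHaveLoops u) :
    IsLeast (objective u '' feasibleSet u) 0 := by
  obtain ⟨z, hz, hz0⟩ := exists_objective_nonpos hu h
  refine ⟨⟨z, hz, le_antisymm hz0 (objective_nonneg hz)⟩, ?_⟩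
  rintro _ ⟨w, hw, rfl⟩
  exact objective_nonneg hw

end Gluing

/-! ### Bitsize estimates -/

section Bitsize

open scoped Nat

/-- Reduction to lowest terms only divides numerator and denominator. The cases a = 0 and b = 0 give
the number 0, of bitsize 0. -/
theorem bitsize_div_le {a b : ℤ} {e : ℕ} (ha : a.natAbs ≤ 2 ^ e) (hb : b.natAbs ≤ 2 ^ e) :
    bitsize ((a : ℚ) / b) ≤ 2 * e := by
  rcases eq_or_ne a 0 with rfl | ha0
  · simp [bitsize]
  rcases eq_or_ne b 0 with rfl | hb0
  · simp [bitsize]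
  have h1 : ((a : ℚ) / b).num.natAbs ≤ 2 ^ e := by
    rw [← Rat.divInt_eq_div]
    exact (Nat.le_of_dvd (Int.natAbs_pos.2 ha0)
      (Int.natAbs_dvd_natAbs.2 (Rat.num_dvd a hb0))).trans ha
  have h2 : ((a : ℚ) / b).den ≤ 2 ^ e := by
    rw [← Rat.divInt_eq_div]
    exact (Nat.le_of_dvd (Int.natAbs_pos.2 hb0)
      (Int.natCast_dvd.1 (Rat.den_dvd a b))).trans hb
  have h3 := (Nat.clog_le_iff_le_pow one_lt_two).2 h1
  have h4 := (Nat.clog_le_iff_le_pow one_lt_two).2 h2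
  rw [bitsize]
  omega

theorem cramer_bound_le_two_pow (m r l : ℕ) :
    m ! * (r * (2 ^ l) ^ 2) ^ m ≤ 2 ^ (m * (m + r + 2 * l)) := by
  have h1 : m ! ≤ 2 ^ (m * m) := by
    rw [pow_mul]
    exact (Nat.factorial_le_pow m).trans (Nat.pow_le_pow_left Nat.lt_two_pow_self.le m)
  have h2 : r * (2 ^ l) ^ 2 ≤ 2 ^ (r + 2 * l) := by
    rw [pow_add, ← pow_mul, mul_comm l 2]
    exact Nat.mul_le_mul_right _ Nat.lt_two_pow_self.le
  calc m ! * (r * (2 ^ l) ^ 2) ^ m ≤ 2 ^ (m * m) * (2 ^ (r + 2 * l)) ^ m :=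
        Nat.mul_le_mul h1 (Nat.pow_le_pow_left h2 m)
    _ = 2 ^ (m * (m + r + 2 * l)) := by
        rw [← pow_mul, ← pow_add]
        congr 1
        ring

theorem card_le_inputSize (u : A → A → ℚ) : Fintype.card A ≤ inputSize u := Nat.le_add_right _ _

theorem bitsize_le_inputSize {u : A → A → ℚ} {i j : A} (hij : 0 < u i j) :
    bitsize (u i j) ≤ inputSize u := by
  have h1 := Finset.single_le_sum (s := Finset.univ.filter fun j => 0 < u i j)
    (f := fun j => 1 + bitsize (u i j)) (fun _ _ => Nat.zero_le _)
    (Finset.mem_filter.2 ⟨Finset.mem_univ j, hij⟩)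
  have h2 := Finset.single_le_sum (f := fun i => ∑ j with 0 < u i j, (1 + bitsize (u i j)))
    (fun _ _ => Nat.zero_le _) (Finset.mem_univ i)
  have h3 := h1.trans h2
  rw [inputSize]
  omega

theorem num_le_two_pow_inputSize {u : A → A → ℚ} (hu : ∀ i j, 0 ≤ u i j) (i j : A) :
    (u i j).num ≤ 2 ^ inputSize u := by
  -- The input size counts only arcs; elsewhere the utility is 0, with numerator 0.
  rcases (hu i j).eq_or_lt with h | h
  · rw [← h]
    simp
  · have h1 : Nat.clog 2 (u i j).num.natAbs ≤ inputSize u :=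
      (Nat.le_add_right _ _).trans (bitsize_le_inputSize h)
    have h2 := (Nat.clog_le_iff_le_pow one_lt_two).1 h1
    zify at h2
    exact (le_abs_self _).trans h2

theorem den_le_two_pow_inputSize {u : A → A → ℚ} (hu : ∀ i j, 0 ≤ u i j) (i j : A) :
    (u i j).den ≤ 2 ^ inputSize u := by
  rcases (hu i j).eq_or_lt with h | h
  · rw [← h]
    exact Nat.one_le_two_pow
  · have h1 : Nat.clog 2 (u i j).den ≤ inputSize u :=
      (Nat.le_add_left _ _).trans (bitsize_le_inputSize h)
    exact (Nat.clog_le_iff_le_pow one_lt_two).1 h1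

end Bitsize

/-! ### Rational optimal vertices of polynomial size -/

section Vertex

/-- Under (⋆) some extreme point of the feasible region is optimal, and it is determined by its
tight constraints. -/
theorem exists_optimal_vertex {u : A → A → ℝ} (hu : ∀ i j, 0 ≤ u i j)
    (h : SingletonComponentsHaveLoops u) :
    ∃ z, IsFeasible u z ∧ objective u z ≤ 0 ∧
      ∀ d, (∀ r, rowFun u r z = rowConst r → rowFun u r d = 0) → d = 0 := by
  obtain ⟨z₀, hz₀, h0⟩ := exists_objective_nonpos hu h
  obtain ⟨-, hc⟩ := (objective_nonpos_iff hz₀).1 h0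
  obtain ⟨z, hz, htight, hk⟩ := exists_vertex_of_mem (rowFun u) (fun r => (rowConst r : ℝ))
    (fun d hd => eq_zero_of_forall_rowFun_eq_zero hd) ((isFeasible_iff_forall_row hu).1 hz₀)
  have hzf : IsFeasible u z := (isFeasible_iff_forall_row hu).2 hz
  -- Optimality of z₀ says that for each ij either y_ij ≥ 0 or u_ij β_i ≤ p_j is tight. Tight rows
  -- of z₀ stay tight at the vertex z, so z inherits this.
  have hbest : ∀ i j, z.pay i j ≠ 0 → u i j * z.invBpb i = z.price j := by
    intro i j hij
    have h1 : z₀.pay i j ≠ 0 := fun hn => hij <| by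
      simpa [rowFun, rowConst] using htight (.inr (.inr (.inr (.inr (.inl (i, j))))))
        (by simpa [rowFun, rowConst] using hn)
    have h2 := htight (.inr (.inr (.inr (.inl (i, j)))))
      (by simp [rowFun, rowConst, hc i j h1])
    simp only [rowFun, rowConst, LinearMap.sub_apply, LinearMap.smul_apply, priceFun_apply,
      invBpbFun_apply, smul_eq_mul, Int.cast_zero] at h2
    linarith
  refine ⟨z, hzf, (objective_nonpos_iff hzf).2 ⟨fun i => ?_, hbest⟩, hk⟩
  obtain ⟨j, -, hj⟩ : ∃ j ∈ Finset.univ, z.pay i j ≠ 0 := by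
    refine Finset.exists_ne_zero_of_sum_ne_zero ?_
    rw [hzf.sum_out]
    exact (hzf.price_pos i).ne'
  refine lt_of_le_of_ne (hzf.invBpb_nonneg i) fun hn => (hzf.price_pos j).ne ?_
  rw [← hbest i j hj, ← hn, mul_zero]

/-- Index set of the variables of the program. -/
abbrev Coord (A : Type*) : Type _ := (A × A) ⊕ A ⊕ A

/-- The variables of the program with given coordinates. -/
def toVars {A : Type*} : (Coord A → ℝ) →ₗ[ℝ] Vars A where
  toFun v := (fun i j => v (.inl (i, j)), fun i => v (.inr (.inl i)), fun i => v (.inr (.inr i)))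
  map_add' _ _ := rfl
  map_smul' _ _ := rfl

/-- The constraints of the program with rational utilities, scaled to have integral coefficients. -/
def intRow (u : A → A → ℚ) (v : Coord A → ℤ) : Row A → ℤ
  | .inl (.inl j) => ∑ i, v (.inl (i, j)) - v (.inr (.inl j))
  | .inl (.inr j) => v (.inr (.inl j)) - ∑ i, v (.inl (i, j))
  | .inr (.inl (.inl i)) => ∑ j, v (.inl (i, j)) - v (.inr (.inl i))
  | .inr (.inl (.inr i)) => v (.inr (.inl i)) - ∑ j, v (.inl (i, j))
  | .inr (.inr (.inl (.inl i))) => v (.inr (.inl i))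
  | .inr (.inr (.inl (.inr i))) => v (.inr (.inr i))
  | .inr (.inr (.inr (.inl ij))) =>
    (u ij.1 ij.2).den * v (.inr (.inl ij.2)) - (u ij.1 ij.2).num * v (.inr (.inr ij.1))
  | .inr (.inr (.inr (.inr (.inl ij)))) => v (.inl ij)
  | .inr (.inr (.inr (.inr (.inr ij)))) => (if 0 < u ij.1 ij.2 then 0 else -1) * v (.inl ij)

/-- The factors by which the constraints are scaled to have integral coefficients. -/
def rowScale {A : Type*} (u : A → A → ℚ) : Row A → ℕ
  | .inr (.inr (.inr (.inl ij))) => (u ij.1 ij.2).den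
  | _ => 1

theorem rowScale_ne_zero {A : Type*} (u : A → A → ℚ) (r : Row A) : (rowScale u r : ℝ) ≠ 0 := by
  rcases r with (j | j) | (i | i) | (i | i) | ij | ij | ij <;> simp [rowScale]

theorem rowScale_mul_rowConst {A : Type*} (u : A → A → ℚ) (r : Row A) :
    (rowScale u r : ℝ) * rowConst r = rowConst r := by
  rcases r with (j | j) | (i | i) | (i | i) | ij | ij | ij <;> simp [rowScale, rowConst]

theorem intRow_cast (u : A → A → ℚ) (v : Coord A → ℤ) (r : Row A) :
    (intRow u v r : ℝ) =
      rowScale u r * rowFun (fun i j => (u i j : ℝ)) r (toVars fun k => (v k : ℝ)) := by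
  rcases r with (j | j) | (i | i) | (i | i) | ij | ij | ij
  · simp [intRow, rowScale, rowFun, toVars]
  · simp [intRow, rowScale, rowFun, toVars]
  · simp [intRow, rowScale, rowFun, toVars]
  · simp [intRow, rowScale, rowFun, toVars]
  · simp [intRow, rowScale, rowFun, toVars]
  · simp [intRow, rowScale, rowFun, toVars]
  · have h1 : ((u ij.1 ij.2).den : ℝ) * (u ij.1 ij.2 : ℝ) = (u ij.1 ij.2).num := by
      have := Rat.den_mul_eq_num (u ij.1 ij.2)
      exact_mod_cast this
    simp only [intRow, rowScale, rowFun, toVars, Int.cast_sub, Int.cast_mul, Int.cast_natCast,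
      LinearMap.sub_apply, LinearMap.smul_apply, priceFun_apply, invBpbFun_apply, smul_eq_mul,
      LinearMap.coe_mk, AddHom.coe_mk, Vars.price, Vars.invBpb]
    rw [← h1]
    ring
  · simp [intRow, rowScale, rowFun, toVars]
  · by_cases h : 0 < u ij.1 ij.2
    · have h' : Arc (fun i j => (u i j : ℝ)) ij.1 ij.2 := by
        change (0 : ℝ) < (u ij.1 ij.2 : ℝ)
        exact_mod_cast h
      simp [intRow, rowScale, rowFun, toVars, h, h']
    · have h' : ¬ Arc (fun i j => (u i j : ℝ)) ij.1 ij.2 := by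
        change ¬ (0 : ℝ) < (u ij.1 ij.2 : ℝ)
        exact_mod_cast h
      simp [intRow, rowScale, rowFun, toVars, h, h']

/-- Applied to unit vectors, this bounds the matrix entries. Balance rows are at most n + 1 ≤ 2 ^ n
for n agents, and bang-per-buck rows are bounded by a numerator or denominator. -/
theorem abs_intRow_le {u : A → A → ℚ} (hu : ∀ i j, 0 ≤ u i j) {v : Coord A → ℤ}
    (hv0 : ∀ k, 0 ≤ v k) (hv1 : ∀ k, v k ≤ 1) (r : Row A) :
    |intRow u v r| ≤ ((2 ^ inputSize u : ℕ) : ℤ) := by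
  have hB : (Fintype.card A : ℤ) + 1 ≤ ((2 ^ inputSize u : ℕ) : ℤ) := by
    have h1 : Fintype.card A < 2 ^ Fintype.card A := Nat.lt_two_pow_self
    have h2 : 2 ^ Fintype.card A ≤ 2 ^ inputSize u :=
      Nat.pow_le_pow_right two_pos (card_le_inputSize u)
    exact_mod_cast h1.trans_le h2
  have hsum : ∀ f : A → Coord A, 0 ≤ ∑ i, v (f i) ∧ ∑ i, v (f i) ≤ Fintype.card A := by
    intro f
    refine ⟨Finset.sum_nonneg fun i _ => hv0 _, ?_⟩
    calc ∑ i, v (f i) ≤ ∑ _i : A, (1 : ℤ) := Finset.sum_le_sum fun i _ => hv1 _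
      _ = Fintype.card A := by simp
  generalize hBdef : ((2 ^ inputSize u : ℕ) : ℤ) = B at hB ⊢
  have hn : (0 : ℤ) ≤ Fintype.card A := Int.natCast_nonneg _
  rw [abs_le]
  rcases r with (j | j) | (i | i) | (i | i) | ij | ij | ij <;> simp only [intRow]
  · have := hsum fun i => .inl (i, j)
    have := hv0 (.inr (.inl j))
    have := hv1 (.inr (.inl j))
    omega
  · have := hsum fun i => .inl (i, j)
    have := hv0 (.inr (.inl j))
    have := hv1 (.inr (.inl j))
    omega
  · have := hsum fun j => .inl (i, j)
    have := hv0 (.inr (.inl i))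
    have := hv1 (.inr (.inl i))
    omega
  · have := hsum fun j => .inl (i, j)
    have := hv0 (.inr (.inl i))
    have := hv1 (.inr (.inl i))
    omega
  · have := hv0 (.inr (.inl i))
    have := hv1 (.inr (.inl i))
    omega
  · have := hv0 (.inr (.inr i))
    have := hv1 (.inr (.inr i))
    omega
  · have hnum : (u ij.1 ij.2).num ≤ B := by
      rw [← hBdef]
      exact_mod_cast num_le_two_pow_inputSize hu ij.1 ij.2
    have hden : ((u ij.1 ij.2).den : ℤ) ≤ B := by
      rw [← hBdef]
      exact_mod_cast den_le_two_pow_inputSize hu ij.1 ij.2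
    have hnum0 : 0 ≤ (u ij.1 ij.2).num := Rat.num_nonneg.2 (hu _ _)
    have hden0 : (0 : ℤ) ≤ (u ij.1 ij.2).den := Int.natCast_nonneg _
    have e1 := mul_nonneg hden0 (hv0 (.inr (.inl ij.2)))
    have e2 := mul_le_of_le_one_right hden0 (hv1 (.inr (.inl ij.2)))
    have e3 := mul_nonneg hnum0 (hv0 (.inr (.inr ij.1)))
    have e4 := mul_le_of_le_one_right hnum0 (hv1 (.inr (.inr ij.1)))
    constructor <;> linarith
  · have := hv0 (.inl ij)
    have := hv1 (.inl ij)
    omega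
  · have := hv0 (.inl ij)
    have := hv1 (.inl ij)
    split_ifs <;> omega

/-- A point determined by its tight constraints is a vector of fractions with a common denominator
of polynomially bounded encoding length. -/
theorem exists_int_fractions_of_vertex {u : A → A → ℚ} (hu : ∀ i j, 0 ≤ u i j) {x : Coord A → ℝ}
    (hk : ∀ d, (∀ r, rowFun (fun i j => (u i j : ℝ)) r (toVars x) = rowConst r →
      rowFun (fun i j => (u i j : ℝ)) r d = 0) → d = 0) :
    ∃ (D : ℤ) (N : Coord A → ℤ), D ≠ 0 ∧ (∀ k, x k = N k / D) ∧
      D.natAbs ≤ 2 ^ (Fintype.card (Coord A) *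
        (Fintype.card (Coord A) + Fintype.card (Row A) + 2 * inputSize u)) ∧
      ∀ k, (N k).natAbs ≤ 2 ^ (Fintype.card (Coord A) *
        (Fintype.card (Coord A) + Fintype.card (Row A) + 2 * inputSize u)) := by
  classical
  set φ := rowFun (fun i j => (u i j : ℝ)) with hφ
  -- Slack rows are replaced by zero equations, so the index set is all of `Row A` whatever the
  -- vertex. The remaining equations determine x.
  set M : Matrix (Row A) (Coord A) ℤ := fun r k =>
    if φ r (toVars x) = rowConst r then intRow u (fun l => if k = l then 1 else 0) r else 0 with hM
  set c : Row A → ℤ := fun r => if φ r (toVars x) = rowConst r then rowConst r else 0 with hc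
  have hMsum : ∀ (v : Coord A → ℝ) (r : Row A), φ r (toVars x) = rowConst r →
      ∑ k, (M r k : ℝ) * v k = rowScale u r * φ r (toVars v) := by
    intro v r hr
    have h1 := LinearMap.pi_apply_eq_sum_univ (φ r ∘ₗ toVars) v
    rw [LinearMap.comp_apply] at h1
    rw [h1, Finset.mul_sum]
    refine Finset.sum_congr rfl fun k _ => ?_
    have h2 := intRow_cast u (fun l => if k = l then 1 else 0) r
    simp only [hM, if_pos hr, h2, LinearMap.comp_apply, smul_eq_mul, Int.cast_ite, Int.cast_one,
      Int.cast_zero]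
    ring
  have hMb : ∀ r k, |M r k| ≤ ((2 ^ inputSize u : ℕ) : ℤ) := by
    intro r k
    simp only [hM]
    split_ifs
    · refine abs_intRow_le hu (fun l => ?_) (fun l => ?_) r <;> split_ifs <;> simp
    · simp
  have hcb : ∀ r, |c r| ≤ ((2 ^ inputSize u : ℕ) : ℤ) := by
    intro r
    have h1 : (1 : ℤ) ≤ ((2 ^ inputSize u : ℕ) : ℤ) := by exact_mod_cast Nat.one_le_two_pow
    have h2 : |(rowConst r : ℤ)| ≤ 1 := by
      rcases r with (j | j) | (i | i) | (i | i) | ij | ij | ij <;> simp [rowConst]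
    simp only [hc]
    split_ifs
    · exact h2.trans h1
    · simp
  have hsol : ∀ r, ∑ k, (M r k : ℝ) * x k = c r := by
    intro r
    by_cases hr : φ r (toVars x) = rowConst r
    · rw [hMsum x r hr, hr, rowScale_mul_rowConst]
      simp only [hc, if_pos hr]
    · simp [hM, hc, hr]
  have huniq : ∀ d : Coord A → ℝ, (∀ r, ∑ k, (M r k : ℝ) * d k = 0) → d = 0 := by
    intro d hd
    have h0 : toVars d = 0 := hk _ fun r hr => by
      have h1 := hd r
      rw [hMsum d r hr] at h1
      exact (mul_eq_zero.1 h1).resolve_left (rowScale_ne_zero u r)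
    funext k
    rcases k with ⟨i, j⟩ | i | i
    · exact congrFun (congrFun (congrArg Prod.fst h0) i) j
    · exact congrFun (congrArg (fun z : Vars A => z.2.1) h0) i
    · exact congrFun (congrArg (fun z : Vars A => z.2.2) h0) i
  obtain ⟨D, N, hD, hN, hDb, hNb⟩ := exists_int_fractions_of_unique_solution M c (2 ^ inputSize u)
    hMb hcb x hsol huniq
  exact ⟨D, N, hD, hN, hDb.trans (cramer_bound_le_two_pow _ _ _),
    fun k => (hNb k).trans (cramer_bound_le_two_pow _ _ _)⟩

theorem outputSize_le {p : A → ℚ} {x : A → A → ℚ} {e : ℕ} (hp : ∀ i, bitsize (p i) ≤ e)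
    (hx : ∀ i j, bitsize (x i j) ≤ e) :
    outputSize p x ≤ (Fintype.card A + Fintype.card A ^ 2) * e := by
  have h1 : ∑ i, bitsize (p i) ≤ Fintype.card A * e := by
    simpa using Finset.sum_le_card_nsmul Finset.univ _ e fun i _ => hp i
  have h2 : ∑ i, ∑ j, bitsize (x i j) ≤ Fintype.card A * (Fintype.card A * e) := by
    have h3 : ∀ i, ∑ j, bitsize (x i j) ≤ Fintype.card A * e := fun i => by
      simpa using Finset.sum_le_card_nsmul Finset.univ _ e fun j _ => hx i j
    simpa using Finset.sum_le_card_nsmul Finset.univ _ _ fun i _ => h3 i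
  calc outputSize p x ≤ Fintype.card A * e + Fintype.card A * (Fintype.card A * e) :=
        Nat.add_le_add h1 h2
    _ = _ := by ring

/-- The polynomial that bounds the encoding length of the equilibrium. -/
noncomputable def sizeBound : Polynomial ℕ :=
  -- With s the input size, n + n² numbers are written, each of bitsize at most 2e with e = m (m + r
  -- + 2s). Here m = n² + 2n counts coordinates and r = 3n² + 6n rows, so m + r + 2s ≤ 4s² + 10s.
  (.X + .X ^ 2) * (2 * ((.X ^ 2 + 2 * .X) * (4 * .X ^ 2 + 10 * .X)))

/-- Under (⋆) a market with rational utilities has a rational optimal extreme point that gives an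
equilibrium of polynomially bounded encoding length. -/
theorem exists_rational_equilibrium {u : A → A → ℚ} (hu : ∀ i j, 0 ≤ u i j)
    (h : SingletonComponentsHaveLoops (fun i j => (u i j : ℝ))) :
    ∃ (y : A → A → ℚ) (p β : A → ℚ),
      ((fun i j => (y i j : ℝ), fun i => (p i : ℝ), fun i => (β i : ℝ)) : Vars A) ∈
        (feasibleSet (fun i j => (u i j : ℝ))).extremePoints ℝ ∧
      IsOptimal (fun i j => (u i j : ℝ))
        (fun i j => (y i j : ℝ), fun i => (p i : ℝ), fun i => (β i : ℝ)) ∧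
      IsEquilibrium (fun i j => (u i j : ℝ)) (fun i => (p i : ℝ))
        (fun i j => ((y i j / p j : ℚ) : ℝ)) ∧
      outputSize p (fun i j => y i j / p j) ≤ sizeBound.eval (inputSize u) := by
  have hu' : ∀ i j, 0 ≤ (u i j : ℝ) := fun i j => by exact_mod_cast hu i j
  obtain ⟨z, hz, hz0, hk⟩ := exists_optimal_vertex hu' h
  set x : Coord A → ℝ := Sum.elim (fun ij => z.pay ij.1 ij.2) (Sum.elim z.price z.invBpb) with hx
  have hxz : toVars x = z := rfl
  obtain ⟨D, N, hD, hN, hDb, hNb⟩ := exists_int_fractions_of_vertex hu (x := x)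
    (by rwa [hxz])
  have hy : ∀ i j, (((N (.inl (i, j)) : ℚ) / D : ℚ) : ℝ) = z.pay i j := fun i j => by
    push_cast
    exact (hN (.inl (i, j))).symm
  have hp : ∀ i, (((N (.inr (.inl i)) : ℚ) / D : ℚ) : ℝ) = z.price i := fun i => by
    push_cast
    exact (hN (.inr (.inl i))).symm
  have hb : ∀ i, (((N (.inr (.inr i)) : ℚ) / D : ℚ) : ℝ) = z.invBpb i := fun i => by
    push_cast
    exact (hN (.inr (.inr i))).symm
  refine ⟨fun i j => N (.inl (i, j)) / D, fun i => N (.inr (.inl i)) / D,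
    fun i => N (.inr (.inr i)) / D, ?_, ?_, ?_, ?_⟩
  · simp only [hy, hp, hb]
    rw [feasibleSet_eq hu']
    exact mem_extremePoints_of_tight _ _ ((isFeasible_iff_forall_row hu').1 hz) hk
  · simp only [hy, hp, hb]
    exact (isOptimal_iff hu' h).2 ⟨hz, hz0⟩
  · simp only [Rat.cast_div (N (.inl _) / D : ℚ), hy, hp]
    exact isEquilibrium_of_objective_nonpos hu' hz hz0
  · have hD' : (D : ℚ) ≠ 0 := by exact_mod_cast hD
    -- The common denominator cancels in y_ij / p_j, so an allocation is a quotient of two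
    -- numerators and obeys the same size bound as a price.
    have hdiv : ∀ i j, (N (.inl (i, j)) / D : ℚ) / (N (.inr (.inl j)) / D)
        = (N (.inl (i, j)) : ℚ) / N (.inr (.inl j)) := fun i j => div_div_div_cancel_right₀ hD' _ _
    simp only [hdiv]
    refine (outputSize_le (fun i => bitsize_div_le (hNb _) hDb)
      (fun i j => bitsize_div_le (hNb _) (hNb _))).trans ?_
    have hn := card_le_inputSize u
    have hC : Fintype.card (Coord A) ≤ inputSize u ^ 2 + 2 * inputSize u := by
      simp only [Fintype.card_sum, Fintype.card_prod]
      nlinarith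
    have hR : Fintype.card (Row A) ≤ 3 * inputSize u ^ 2 + 6 * inputSize u := by
      simp only [Fintype.card_sum, Fintype.card_prod]
      nlinarith
    simp only [sizeBound, Polynomial.eval_mul, Polynomial.eval_add, Polynomial.eval_pow,
      Polynomial.eval_X, Polynomial.eval_ofNat]
    refine Nat.mul_le_mul (Nat.add_le_add hn (Nat.pow_le_pow_left hn 2))
      (Nat.mul_le_mul le_rfl (Nat.mul_le_mul hC ?_))
    linarith

end Vertex

end ArrowDebreu

/-! ### The main theorem -/

theorem theorem1 :
    (∀ (A : Type*) [Fintype A] (u : A → A → ℝ), (∀ i j, 0 ≤ u i j) →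
      ArrowDebreu.IsConvexProgram u ∧
      ((ArrowDebreu.feasibleSet u).Nonempty ↔ ArrowDebreu.SingletonComponentsHaveLoops u) ∧
      (ArrowDebreu.SingletonComponentsHaveLoops u →
        IsLeast (ArrowDebreu.objective u '' ArrowDebreu.feasibleSet u) 0 ∧
        ∀ z : ArrowDebreu.Vars A, ArrowDebreu.IsOptimal u z →
          ArrowDebreu.IsEquilibrium u z.price (fun i j => z.pay i j / z.price j))) ∧
    (∃ P : Polynomial ℕ, ∀ (A : Type*) [Fintype A] (u : A → A → ℚ), (∀ i j, 0 ≤ u i j) →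
      ArrowDebreu.SingletonComponentsHaveLoops (fun i j => (u i j : ℝ)) →
      ∃ (y : A → A → ℚ) (p β : A → ℚ),
        ((fun i j => (y i j : ℝ), fun i => (p i : ℝ), fun i => (β i : ℝ)) : ArrowDebreu.Vars A) ∈
          (ArrowDebreu.feasibleSet (fun i j => (u i j : ℝ))).extremePoints ℝ ∧
        ArrowDebreu.IsOptimal (fun i j => (u i j : ℝ))
          (fun i j => (y i j : ℝ), fun i => (p i : ℝ), fun i => (β i : ℝ)) ∧
        ArrowDebreu.IsEquilibrium (fun i j => (u i j : ℝ)) (fun i => (p i : ℝ))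
          (fun i j => ((y i j / p j : ℚ) : ℝ)) ∧
        ArrowDebreu.outputSize p (fun i j => y i j / p j) ≤ P.eval (ArrowDebreu.inputSize u)) := by
  refine ⟨fun A _ u hu => ⟨ArrowDebreu.isConvexProgram hu, ⟨?_, fun h => ?_⟩, fun h =>
    ⟨ArrowDebreu.isLeast_objective hu h, fun z hz => ?_⟩⟩,
    ArrowDebreu.sizeBound, fun A _ u hu h => ArrowDebreu.exists_rational_equilibrium hu h⟩
  · rintro ⟨z, hz⟩
    exact ArrowDebreu.singletonComponentsHaveLoops_of_isFeasible hz
  · obtain ⟨z, hz, -⟩ := ArrowDebreu.exists_objective_nonpos hu h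
    exact ⟨z, hz⟩
  · obtain ⟨hz, hz0⟩ := (ArrowDebreu.isOptimal_iff hu h).1 hz
    exact ArrowDebreu.isEquilibrium_of_objective_nonpos hu hz hz0
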